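/- All groups are finite and $p$ is a prime. A group $G$ is \emph{$p$-solvable} if every chief factor of $G$ is a $p$-group or a $p'$-group, and a $p$-solvable group is \emph{$p$-supersolvable} if every chief factor of it that is a $p$-group has order $p$. Let $G^{\mathfrak{U}_p}$ denote the $p$-supersolvable residual of $G$, i.e. the smallest normal subgroup of $G$ whose quotient is $p$-supersolvable. For subgroups $H \le K \le G$, we say that $H$ is \emph{$c$-embedded in $G$ with respect to $K$} if there is a subgroup $B$ of $G$ such that $G = HB$ and $H \cap B \le Z(K)$. A group is \emph{quaternion-free} if it has no section isomorphic to the quaternion group of order $8$. Write $P^x = x^{-1}Px$. \textbf{Theorem A.} Let $P$ be a Sylow $p$-subgroup of a $p$-solvable group $G$. Then $G$ is $p$-supersolvable if and only if the following two conditions are satisfied: (1) $N_G(P)$ is $p$-supersolvable. (2) For all $x \in G \setminus N_G(P)$, the following hold: every subgroup of $G^{\mathfrak{U}_p} \cap P \cap P^x$ of order $p$ is $c$-embedded in $G$ with respect to $P$; moreover, if $p = 2$ and $G^{\mathfrak{U}_p} \cap P \cap P^x$ is not quaternion-free, then every cyclic subgroup of $G^{\mathfrak{U}_p} \cap P \cap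 P^x$ of order $4$ is $c$-embedded in $G$ with respect to $P$. -/

import Mathlib

open scoped Pointwise

/-- `K / H` is a chief factor of `G`: `H < K` are normal subgroups of `G`, and no normal subgroup
of `G` lies strictly between them. The order of `K / H` is `H.relIndex K`. -/
structure IsChiefFactor {G : Type*} [Group G] (H K : Subgroup G) : Prop where
  normal_bot : H.Normal
  normal_top : K.Normal
  lt : H < K
  eq_or_eq : ∀ N : Subgroup G, N.Normal → H ≤ N → N ≤ K → N = H ∨ N = K

/-- A finite group is `p`-solvable if each of its chief factors is a `p`-group (its order is a
power of `p`) or a `p'`-group (its order is coprime to `p`). -/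
def IsPSolvable (p : ℕ) (G : Type*) [Group G] : Prop :=
  ∀ H K : Subgroup G, IsChiefFactor H K →
    (∃ n : ℕ, H.relIndex K = p ^ n) ∨ p.Coprime (H.relIndex K)

/-- A finite group is `p`-supersolvable if it is `p`-solvable and each of its chief factors that
is a `p`-group has order `p`. -/
def IsPSupersolvable (p : ℕ) (G : Type*) [Group G] : Prop :=
  IsPSolvable p G ∧
    ∀ H K : Subgroup G, IsChiefFactor H K → (∃ n : ℕ, H.relIndex K = p ^ n) → H.relIndex K = p

/-- The `p`-supersolvable residual of `G`: the intersection of all normal subgroups of `G` with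
`p`-supersolvable quotient. For finite `G` it is the smallest such normal subgroup. -/
def pSupersolvableResidual (p : ℕ) (G : Type*) [Group G] : Subgroup G :=
  sInf {N : Subgroup G | ∃ _ : N.Normal, IsPSupersolvable p (G ⧸ N)}

/-- `H` is `c`-embedded in `G` with respect to `K`, where `H ≤ K ≤ G`: there is a subgroup `B` of
`G` with `G = HB` and `H ∩ B ≤ Z(K)`. -/
def IsCEmbedded {G : Type*} [Group G] (H K : Subgroup G) : Prop :=
  H ≤ K ∧ ∃ B : Subgroup G, (H : Set G) * (B : Set G) = Set.univ ∧
    H ⊓ B ≤ (Subgroup.center K).map K.subtype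

/-- A group is quaternion-free if no section `A / B` of it (with `B ⊴ A ≤ G`) is isomorphic to
the quaternion group of order `8`. -/
def IsQuaternionFree (G : Type*) [Group G] : Prop :=
  ∀ (A : Subgroup G) (B : Subgroup A) [B.Normal], IsEmpty (A ⧸ B ≃* QuaternionGroup 2)

/-- The intersection `G^{𝔘_p} ∩ P ∩ P^x`, where `P^x = x⁻¹ P x`. -/
def residualInter {G : Type*} [Group G] {p : ℕ} (P : Sylow p G) (x : G) : Subgroup G :=
  pSupersolvableResidual p G ⊓ (P : Subgroup G) ⊓ ((x⁻¹ • P : Sylow p G) : Subgroup G)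

/-!
If `G` is `p`-supersolvable, its residual is trivial and condition (2) is vacuous. The converse is
an induction on the order of `G`.

Supersolvability is handled through normal series: `HasNormalSeries C N` says that a normal series
runs from `N` to `G` with all indices in `C`, and by a Jordan–Hölder argument this means that all
chief factors above `N` have order in `C`. Hence the quotient by `N` is `p`-supersolvable if and
only if such a series starts at `N`, if and only if `N` contains the residual `R`.

Both conditions pass to subgroups above `P` (`EmbeddingCondition.subtype`) and to quotients by
normal `p'`-subgroups (`EmbeddingCondition.mapSurjective`), so one may assume that `G` has no
nontrivial normal `p'`-subgroup and that proper subgroups `M ≥ P` are `p`-supersolvable. By the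
Hall–Higman lemma `IsPSolvable.centralizer_le`, the largest normal `p`-subgroup `N` contains its
centralizer; this forces `P` to be normal in every such `M` (`IsPSupersolvable.sylow_normal`). So
either `P` is normal, or `N_G(P)` is the only maximal subgroup above `P`. In the latter case the
preimage in `G` of the largest normal `p'`-subgroup of `G / N` supplements `P`, whence `R ≤ N` is a
normal `p`-subgroup (`residual_le_normalCore`), and `R ∩ P ∩ P ^ x = R` for all `x`.

By minimality of `R`, no normal subgroup of `G` has index `p` in `R`. If `⟨a⟩ ≤ R` has order `p` and
`G = ⟨a⟩ B` with `a ∉ B`, then `B ∩ R` would be such a subgroup (`exists_normal_relIndex_eq_prime`).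
So `a ∈ B`, and `a` is centralized by `P`; as the normal closure of `P` is `G`, the elements of `R`
of order `p` are central in `G`. The same is true of those of order `4` if `p = 2` and `R` is not
quaternion-free. The theorem on coprime action `IsPGroup.fixed_of_fixed_of_pow_eq_one` now shows
that the `p'`-elements of `G` centralize `R`, so a chief factor of `G` at the top of `R` has
order `p`, a contradiction.
-/

open scoped commutatorElement

/-! ### Normal series -/

/-- There is a chain `N = N₀ ≤ N₁ ≤ ⋯ ≤ Nₖ = G` of normal subgroups of `G` all of whose successive
indices satisfy `C`. -/
inductive HasNormalSeries (C : ℕ → Prop) {G : Type*} [Group G] : Subgroup G → Prop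
  | top : HasNormalSeries C ⊤
  | step {N K : Subgroup G} : N.Normal → N ≤ K → C (N.relIndex K) → HasNormalSeries C K →
      HasNormalSeries C N

/-- The predicate `C` passes to divisors. -/
def DvdClosed (C : ℕ → Prop) : Prop := ∀ m n, m ∣ n → C n → C m

theorem Subgroup.relIndex_dvd_of_le_right_of_normal {G : Type*} [Group G] {N L K : Subgroup G}
    [N.Normal] (h : L ≤ K) : N.relIndex L ∣ N.relIndex K := by
  rw [← Subgroup.relIndex_subgroupOf h]
  exact Subgroup.relIndex_dvd_index_of_normal _ _

theorem Subgroup.relIndex_sup_sup_dvd {G : Type*} [Group G] {N K X : Subgroup G} [N.Normal]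
    [X.Normal] (h : N ≤ K) : (N ⊔ X).relIndex (K ⊔ X) ∣ N.relIndex K := by
  have h1 : K ⊔ X = K ⊔ (N ⊔ X) := by
    rw [← sup_assoc, sup_eq_left.2 h]
  rw [h1, Subgroup.relIndex_sup_right]
  exact Subgroup.relIndex_dvd_of_le_left _ le_sup_left

theorem Subgroup.inf_relIndex_inf_dvd {G : Type*} [Group G] {N L K : Subgroup G} [L.Normal] :
    (N ⊓ L).relIndex (N ⊓ K) ∣ L.relIndex K := by
  have h1 : (N ⊓ L).relIndex (N ⊓ K) = L.relIndex (N ⊓ K) := by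
    rw [← Subgroup.inf_relIndex_right L, ← Subgroup.inf_relIndex_right (N ⊓ L)]
    congr 1
    ext x
    simp only [Subgroup.mem_inf]
    tauto
  rw [h1]
  exact Subgroup.relIndex_dvd_of_le_right_of_normal inf_le_right

theorem Subgroup.sup_inf_of_le_of_normal {G : Type*} [Group G] {H M K : Subgroup G} [M.Normal]
    (h : H ≤ K) : (H ⊔ M) ⊓ K = H ⊔ M ⊓ K := by
  refine le_antisymm ?_ (le_inf (sup_le_sup_left inf_le_left H) (sup_le h inf_le_right))
  rintro x ⟨hx, hxK⟩
  obtain ⟨a, ha, b, hb, rfl⟩ := Subgroup.mem_sup_of_normal_right.1 hx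
  exact mul_mem (Subgroup.mem_sup_left ha)
    (Subgroup.mem_sup_right ⟨hb, (Subgroup.mul_mem_cancel_left K (h ha)).1 hxK⟩)

namespace HasNormalSeries

variable {C : ℕ → Prop} {G : Type*} [Group G]

theorem normal {N : Subgroup G} (h : HasNormalSeries C N) : N.Normal := by
  cases h with
  | top => infer_instance
  | step h _ _ _ => exact h

theorem comap (hC : DvdClosed C) {G' : Type*} [Group G'] (f : G →* G') {N : Subgroup G'}
    (h : HasNormalSeries C N) : HasNormalSeries C (N.comap f) := by
  induction h with
  | top => rw [Subgroup.comap_top]; exact .top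
  | @step N K hN hNK hidx _ ih =>
    refine .step (hN.comap f) (Subgroup.comap_mono hNK) (hC _ _ ?_ hidx) ih
    rw [Subgroup.relIndex_comap]
    exact Subgroup.relIndex_dvd_of_le_right_of_normal (Subgroup.map_comap_le f K)

theorem map (hC : DvdClosed C) {G' : Type*} [Group G'] {f : G →* G'} (hf : Function.Surjective f)
    {N : Subgroup G} (h : HasNormalSeries C N) : HasNormalSeries C (N.map f) := by
  induction h with
  | top => rw [Subgroup.map_top_of_surjective f hf]; exact .top
  | @step N K hN hNK hidx _ ih =>
    refine .step (hN.map f hf) (Subgroup.map_mono hNK) (hC _ _ ?_ hidx) ih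
    rw [Subgroup.relIndex_map_map]
    exact Subgroup.relIndex_sup_sup_dvd hNK

theorem inf (hC : DvdClosed C) {N M : Subgroup G} (hN : HasNormalSeries C N)
    (hM : HasNormalSeries C M) : HasNormalSeries C (N ⊓ M) := by
  induction hM with
  | top => rwa [inf_top_eq]
  | @step M K hMn hMK hidx _ ih =>
    have := hN.normal
    refine .step inferInstance (inf_le_inf_left N hMK) (hC _ _ ?_ hidx) ih
    exact Subgroup.inf_relIndex_inf_dvd

/-- A Jordan–Hölder argument: a chief factor above `N` is isomorphic to a section of one of the
factors of any series from `N`. -/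
theorem relIndex_of_isChiefFactor (hC : DvdClosed C) {N : Subgroup G} (h : HasNormalSeries C N) :
    ∀ {H K : Subgroup G}, IsChiefFactor H K → N ≤ H → C (H.relIndex K) := by
  induction h with
  | top => exact fun hHK hH => absurd (hHK.lt.trans_le le_top) (top_le_iff.1 hH ▸ lt_irrefl _)
  | @step N M hN hNM hidx hM ih =>
    intro H K hHK hH
    have := hM.normal
    have := hHK.normal_bot
    have := hHK.normal_top
    rcases hHK.eq_or_eq ((K ⊓ M) ⊔ H) inferInstance le_sup_right
      (sup_le inf_le_left hHK.lt.le) with h1 | h1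
    · -- `K ∩ M ≤ H`, so `KM / HM` is a chief factor isomorphic to `K / H`
      have hKM : K ⊓ M ≤ H := by rw [← h1]; exact le_sup_left
      have hmod : (H ⊔ M) ⊓ K = H := by
        rw [Subgroup.sup_inf_of_le_of_normal hHK.lt.le, inf_comm, sup_eq_left.2 hKM]
      have hidx' : (H ⊔ M).relIndex (K ⊔ M) = H.relIndex K := by
        have h2 : K ⊔ M = K ⊔ (H ⊔ M) := by rw [← sup_assoc, sup_eq_left.2 hHK.lt.le]
        rw [h2, Subgroup.relIndex_sup_right, ← Subgroup.inf_relIndex_right, hmod]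
      rw [← hidx']
      refine ih ⟨inferInstance, inferInstance, lt_of_le_of_ne (sup_le_sup_right hHK.lt.le M) ?_, ?_⟩
        le_sup_right
      · intro heq
        apply hHK.lt.not_ge
        rw [← hmod, heq]
        exact le_inf le_sup_left le_rfl
      · intro X hX hHX hXK
        have hMX : M ≤ X := le_sup_right.trans hHX
        have hXeq : X = (X ⊓ K) ⊔ M := by
          have := Subgroup.sup_inf_of_le_of_normal (M := K) hMX
          rw [sup_comm M K, inf_eq_right.2 hXK] at this
          rw [inf_comm, sup_comm]
          exact this
        rcases hHK.eq_or_eq (X ⊓ K) inferInstance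
          (le_inf (le_sup_left.trans hHX) hHK.lt.le) inf_le_right with h3 | h3
        · left; rw [hXeq, h3]
        · right; rw [hXeq, h3]
    · refine hC _ _ ?_ hidx
      have h2 : H.relIndex K = H.relIndex (K ⊓ M) := by
        rw [← Subgroup.relIndex_sup_right (H := K ⊓ M) (K := H), h1]
      rw [h2]
      exact (Subgroup.relIndex_dvd_of_le_left _ hH).trans
        (Subgroup.relIndex_dvd_of_le_right_of_normal inf_le_right)

end HasNormalSeries

theorem exists_isChiefFactor {G : Type*} [Group G] [Finite G] {H L : Subgroup G} [hH : H.Normal]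
    [hL : L.Normal] (hHL : H < L) : ∃ K, IsChiefFactor H K ∧ K ≤ L := by
  obtain ⟨K, hK, hmin⟩ := (Set.toFinite {K : Subgroup G | K.Normal ∧ H < K ∧ K ≤ L}).exists_minimal
    ⟨L, hL, hHL, le_rfl⟩
  refine ⟨K, ⟨hH, hK.1, hK.2.1, fun N hN hHN hNK => ?_⟩, hK.2.2⟩
  rcases eq_or_lt_of_le hHN with h | h
  · exact .inl h.symm
  · exact .inr (le_antisymm hNK (hmin ⟨hN, h, hNK.trans hK.2.2⟩ hNK))

/-- A maximal normal subgroup of `G` properly contained in `K` is the bottom of a chief factor. -/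
theorem exists_isChiefFactor_top {G : Type*} [Group G] [Finite G] {H L : Subgroup G} [hH : H.Normal]
    [hL : L.Normal] (hHL : H < L) : ∃ K, IsChiefFactor K L ∧ H ≤ K := by
  obtain ⟨K, hK, hmax⟩ := (Set.toFinite {K : Subgroup G | K.Normal ∧ K < L ∧ H ≤ K}).exists_maximal
    ⟨H, hH, hHL, le_rfl⟩
  refine ⟨K, ⟨hK.1, hL, hK.2.1, fun N hN hKN hNL => ?_⟩, hK.2.2⟩
  rcases eq_or_lt_of_le hNL with h | h
  · exact .inr h
  · exact .inl (le_antisymm (hmax ⟨hN, h, hK.2.2.trans hKN⟩ hKN) hKN)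

theorem hasNormalSeries_of_isChiefFactor {C : ℕ → Prop} {G : Type*} [Group G] [Finite G]
    (N : Subgroup G) [hN : N.Normal]
    (h : ∀ H K : Subgroup G, IsChiefFactor H K → N ≤ H → C (H.relIndex K)) :
    HasNormalSeries C N := by
  revert hN h
  induction N using WellFoundedGT.induction with
  | ind N ih =>
    intro hN h
    rcases eq_or_lt_of_le (le_top : N ≤ ⊤) with rfl | hlt
    · exact .top
    · obtain ⟨K, hK, -⟩ := exists_isChiefFactor hlt
      have := hK.normal_top
      exact .step hN hK.lt.le (h N K hK le_rfl)
        (ih K hK.lt fun H K' hHK hH => h H K' hHK (hK.lt.le.trans hH))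

/-- The indices allowed in a `p`-solvable series: divisors of powers of `p`, and `p'`-numbers. -/
def PSolvableIndex (p n : ℕ) : Prop := (∃ k, n ∣ p ^ k) ∨ p.Coprime n

/-- The indices allowed in a `p`-supersolvable series: divisors of `p`, and `p'`-numbers. -/
def PSupersolvableIndex (p n : ℕ) : Prop := n ∣ p ∨ p.Coprime n

theorem dvdClosed_pSolvableIndex (p : ℕ) : DvdClosed (PSolvableIndex p) := by
  rintro m n hmn (⟨k, hk⟩ | h)
  · exact .inl ⟨k, hmn.trans hk⟩
  · exact .inr (h.coprime_dvd_right hmn)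

theorem dvdClosed_pSupersolvableIndex (p : ℕ) : DvdClosed (PSupersolvableIndex p) := by
  rintro m n hmn (h | h)
  · exact .inl (hmn.trans h)
  · exact .inr (h.coprime_dvd_right hmn)

section

variable {G : Type*} [Group G] [Finite G] {p : ℕ} [hp : Fact p.Prime]

theorem isPSolvable_iff : IsPSolvable p G ↔ HasNormalSeries (PSolvableIndex p) (⊥ : Subgroup G) := by
  constructor
  · refine fun h => hasNormalSeries_of_isChiefFactor ⊥ fun H K hHK _ => ?_
    rcases h H K hHK with ⟨n, hn⟩ | h
    · exact .inl ⟨n, hn.dvd⟩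
    · exact .inr h
  · intro h H K hHK
    rcases h.relIndex_of_isChiefFactor (dvdClosed_pSolvableIndex p) hHK bot_le with ⟨k, hk⟩ | h
    · obtain ⟨n, -, hn⟩ := (Nat.dvd_prime_pow hp.out).1 hk
      exact .inl ⟨n, hn⟩
    · exact .inr h

theorem isPSupersolvable_iff :
    IsPSupersolvable p G ↔ HasNormalSeries (PSupersolvableIndex p) (⊥ : Subgroup G) := by
  constructor
  · refine fun h => hasNormalSeries_of_isChiefFactor ⊥ fun H K hHK _ => ?_
    rcases h.1 H K hHK with hn | h'
    · exact .inl (h.2 H K hHK hn).dvd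
    · exact .inr h'
  · intro h
    have key : ∀ H K : Subgroup G, IsChiefFactor H K →
        H.relIndex K = p ∨ p.Coprime (H.relIndex K) := by
      intro H K hHK
      rcases h.relIndex_of_isChiefFactor (dvdClosed_pSupersolvableIndex p) hHK bot_le with hk | h
      · rcases (Nat.dvd_prime hp.out).1 hk with h1 | h1
        · exact absurd (Subgroup.relIndex_eq_one.1 h1) hHK.lt.not_ge
        · exact .inl h1
      · exact .inr h
    refine ⟨fun H K hHK => ?_, fun H K hHK ⟨n, hn⟩ => ?_⟩
    · rcases key H K hHK with h1 | h1
      · exact .inl ⟨1, by rw [h1, pow_one]⟩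
      · exact .inr h1
    · rcases key H K hHK with h1 | h1
      · exact h1
      · rw [hn] at h1
        rcases Nat.eq_zero_or_pos n with rfl | hpos
        · rw [pow_zero] at hn
          exact absurd (Subgroup.relIndex_eq_one.1 hn) hHK.lt.not_ge
        · exact absurd ((Nat.coprime_pow_right_iff hpos p p).1 h1)
            (fun h2 => hp.out.one_lt.ne' ((Nat.coprime_self p).1 h2))

theorem isPSupersolvable_quotient_iff (N : Subgroup G) [N.Normal] :
    IsPSupersolvable p (G ⧸ N) ↔ HasNormalSeries (PSupersolvableIndex p) N := by
  rw [isPSupersolvable_iff]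
  constructor
  · intro h
    have := h.comap (dvdClosed_pSupersolvableIndex p) (QuotientGroup.mk' N)
    rwa [MonoidHom.comap_bot, QuotientGroup.ker_mk'] at this
  · intro h
    have := h.map (dvdClosed_pSupersolvableIndex p) (QuotientGroup.mk'_surjective N)
    rwa [QuotientGroup.map_mk'_self] at this

theorem IsPSupersolvable.of_injective {G' : Type*} [Group G'] [Finite G'] (h : IsPSupersolvable p G)
    (f : G' →* G) (hf : Function.Injective f) : IsPSupersolvable p G' := by
  rw [isPSupersolvable_iff] at h ⊢
  have := h.comap (dvdClosed_pSupersolvableIndex p) f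
  rwa [MonoidHom.comap_bot, (MonoidHom.ker_eq_bot_iff f).2 hf] at this

theorem IsPSolvable.of_injective {G' : Type*} [Group G'] [Finite G'] (h : IsPSolvable p G)
    (f : G' →* G) (hf : Function.Injective f) : IsPSolvable p G' := by
  rw [isPSolvable_iff] at h ⊢
  have := h.comap (dvdClosed_pSolvableIndex p) f
  rwa [MonoidHom.comap_bot, (MonoidHom.ker_eq_bot_iff f).2 hf] at this

theorem IsPSupersolvable.of_surjective {G' : Type*} [Group G'] [Finite G']
    (h : IsPSupersolvable p G) (f : G →* G') (hf : Function.Surjective f) :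
    IsPSupersolvable p G' := by
  rw [isPSupersolvable_iff] at h ⊢
  have := h.map (dvdClosed_pSupersolvableIndex p) hf
  rwa [Subgroup.map_bot] at this

theorem IsPSolvable.of_surjective {G' : Type*} [Group G'] [Finite G'] (h : IsPSolvable p G)
    (f : G →* G') (hf : Function.Surjective f) : IsPSolvable p G' := by
  rw [isPSolvable_iff] at h ⊢
  have := h.map (dvdClosed_pSolvableIndex p) hf
  rwa [Subgroup.map_bot] at this

variable (G p) in
theorem hasNormalSeries_residual :
    HasNormalSeries (PSupersolvableIndex p) (pSupersolvableResidual p G) := by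
  have key : ∀ S : Set (Subgroup G), S.Finite →
      (∀ N ∈ S, HasNormalSeries (PSupersolvableIndex p) N) →
      HasNormalSeries (PSupersolvableIndex p) (sInf S) := by
    intro S hS
    induction S, hS using Set.Finite.induction_on with
    | empty => intro _; rw [sInf_empty]; exact .top
    | insert _ _ ih =>
      intro h
      rw [sInf_insert]
      exact (h _ (Set.mem_insert _ _)).inf (dvdClosed_pSupersolvableIndex p)
        (ih fun N hN => h N (Set.mem_insert_of_mem _ hN))
  refine key _ (Set.toFinite _) ?_
  rintro N ⟨hN, h⟩
  exact (isPSupersolvable_quotient_iff N).1 h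

instance pSupersolvableResidual_normal : (pSupersolvableResidual p G).Normal :=
  (hasNormalSeries_residual G p).normal

theorem pSupersolvableResidual_le {N : Subgroup G}
    (h : HasNormalSeries (PSupersolvableIndex p) N) : pSupersolvableResidual p G ≤ N :=
  have := h.normal
  sInf_le ⟨this, (isPSupersolvable_quotient_iff N).2 h⟩

theorem IsPSupersolvable.residual_eq_bot (h : IsPSupersolvable p G) :
    pSupersolvableResidual p G = ⊥ :=
  le_bot_iff.1 (pSupersolvableResidual_le (isPSupersolvable_iff.1 h))

theorem isPSupersolvable_of_residual_eq_bot (h : pSupersolvableResidual p G = ⊥) :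
    IsPSupersolvable p G :=
  isPSupersolvable_iff.2 (h ▸ hasNormalSeries_residual G p)

theorem map_residual_subtype_le (M : Subgroup G) :
    (pSupersolvableResidual p M).map M.subtype ≤ pSupersolvableResidual p G :=
  Subgroup.map_le_iff_le_comap.2 (pSupersolvableResidual_le
    ((hasNormalSeries_residual G p).comap (dvdClosed_pSupersolvableIndex p) M.subtype))

theorem residual_le_map {G' : Type*} [Group G'] [Finite G'] {f : G →* G'}
    (hf : Function.Surjective f) :
    pSupersolvableResidual p G' ≤ (pSupersolvableResidual p G).map f :=
  pSupersolvableResidual_le ((hasNormalSeries_residual G p).map (dvdClosed_pSupersolvableIndex p) hf)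

end

/-! ### Sections isomorphic to the quaternion group -/

theorem IsQuaternionFree.of_injective {G G' : Type*} [Group G] [Group G'] (h : IsQuaternionFree G)
    (f : G' →* G) (hf : Function.Injective f) : IsQuaternionFree G' := by
  intro A B hB
  refine ⟨fun e => ?_⟩
  let a := A.equivMapOfInjective f hf
  have : (B.map (a : A →* A.map f)).Normal := hB.map _ a.surjective
  exact (h (A.map f) (B.map (a : A →* A.map f))).false
    ((QuotientGroup.congr B (B.map (a : A →* A.map f)) a rfl).symm.trans e)

theorem not_isQuaternionFree_of_quotient {G : Type*} [Group G] (N : Subgroup G) [N.Normal]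
    (φ : QuaternionGroup 2 →* G ⧸ N) (hφ : Function.Injective φ) : ¬ IsQuaternionFree G := by
  intro h
  let f := (QuotientGroup.mk' N).subgroupComap φ.range
  have hf : Function.Surjective f :=
    (QuotientGroup.mk' N).subgroupComap_surjective_of_surjective _ (QuotientGroup.mk'_surjective N)
  exact (h (φ.range.comap (QuotientGroup.mk' N)) f.ker).false
    ((QuotientGroup.quotientKerEquivOfSurjective f hf).trans (MonoidHom.ofInjective hφ).symm)

/-- Two elements with the same square `z` of order `2` and with commutator `z` generate a copy of
the quaternion group of order `8`. -/
theorem exists_quaternionGroup_hom {E : Type*} [Group E] {x y z : E} (hx : x ^ 2 = z)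
    (hy : y ^ 2 = z) (hz : z ^ 2 = 1) (hz1 : z ≠ 1) (hxy : x * y = z * (y * x)) :
    ∃ φ : QuaternionGroup 2 →* E, Function.Injective φ := by
  have hx4 : x ^ 4 = 1 := by rw [show 4 = 2 * 2 from rfl, pow_mul, hx, hz]
  have hzx : z = x⁻¹ * x⁻¹ := by
    rw [← mul_inv_rev, ← sq, hx]
    exact eq_inv_of_mul_eq_one_left (by rw [← sq, hz])
  have hzy : Commute z y := by rw [← hy]; exact (Commute.refl y).pow_left 2
  have hsemi : SemiconjBy y x⁻¹ x := by
    change y * x⁻¹ = x * y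
    have hzinv : z * x = x⁻¹ := by rw [hzx]; group
    rw [hxy, ← mul_assoc, hzy.eq, mul_assoc, hzinv]
  let g : ZMod (2 * 2) →+ Additive E :=
    ZMod.lift (2 * 2) ⟨zmultiplesHom (Additive E) (Additive.ofMul x), by
      change Additive.ofMul (x ^ (4 : ℤ)) = 0
      rw [show (4 : ℤ) = ((4 : ℕ) : ℤ) from rfl, zpow_natCast, hx4]; rfl⟩
  let X : ZMod (2 * 2) → E := fun i => (g i).toMul
  have hXint : ∀ k : ℤ, X k = x ^ k := fun k => by
    simp only [X, g, ZMod.lift_coe]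
    rfl
  have hXadd : ∀ i j, X (i + j) = X i * X j := fun i j => by simp only [X, map_add, toMul_add]
  have hXsub : ∀ i j, X (j - i) = (X i)⁻¹ * X j := fun i j => by
    rw [sub_eq_neg_add, hXadd]
    congr 1
    simp only [X, map_neg, toMul_neg]
  have hXy : ∀ i, X i * y = y * (X i)⁻¹ := fun i => by
    obtain ⟨k, rfl⟩ := ZMod.intCast_surjective i
    rw [hXint, ← inv_zpow]
    exact (hsemi.zpow_right k).eq.symm
  have hX2 : X ((2 : ℕ) : ZMod (2 * 2)) = z := by
    have := hXint 2
    rw [zpow_ofNat, hx] at this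
    exact this
  have hxinv : x ≠ x⁻¹ := fun h => hz1 (by rw [← hx, sq]; nth_rewrite 1 [h]; exact inv_mul_cancel x)
  have hX1 : ∀ i, X i = 1 → i = 0 := by
    intro i hi
    have h1 := hXint 1
    have h2 := hXint 2
    have h3 := hXint 3
    have hx1 : x ≠ 1 := by rintro rfl; exact hxinv (by simp)
    fin_cases i
    · rfl
    · exact absurd ((zpow_one x).symm.trans (h1.symm.trans hi)) hx1
    · exact absurd (hx.symm.trans ((zpow_ofNat x 2).symm.trans (h2.symm.trans hi))) hz1
    · have h3' : x ^ 3 = 1 := (zpow_ofNat x 3).symm.trans (h3.symm.trans hi)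
      rw [pow_succ, h3', one_mul] at hx4
      exact absurd hx4 hx1
  let F : QuaternionGroup 2 → E := fun q => match q with
    | .a i => X i
    | .xa i => y * X i
  have hF : ∀ q r, F (q * r) = F q * F r := by
    rintro (i | i) (j | j)
    · rw [QuaternionGroup.a_mul_a]; exact hXadd i j
    · rw [QuaternionGroup.a_mul_xa]
      change y * X (j - i) = X i * (y * X j)
      rw [hXsub, ← mul_assoc (X i), hXy, mul_assoc]
    · rw [QuaternionGroup.xa_mul_a]
      change y * X (i + j) = y * X i * X j
      rw [hXadd, mul_assoc]
    · rw [QuaternionGroup.xa_mul_xa]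
      change X (_ + j - i) = y * X i * (y * X j)
      rw [add_sub_assoc, hXadd, hX2, hXsub, ← hy, mul_assoc y, ← mul_assoc (X i), hXy, sq]
      group
  refine ⟨MonoidHom.mk' F hF, (injective_iff_map_eq_one _).2 ?_⟩
  rintro (i | i) hi
  · change X i = 1 at hi
    rw [hX1 i hi]; rfl
  · exfalso
    change y * X i = 1 at hi
    have hyX : y = (X i)⁻¹ := eq_inv_of_mul_eq_one_left hi
    have hcomm : Commute y x := by
      rw [hyX]
      obtain ⟨k, rfl⟩ := ZMod.intCast_surjective i
      rw [hXint]
      exact ((Commute.refl x).zpow_left k).inv_left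
    have h1 : y * x⁻¹ = y * x := hsemi.eq.trans hcomm.eq.symm
    exact hxinv (mul_left_cancel h1).symm


/-! ### Coprime action on `p`-groups -/

/-- If `x⁻¹ α(x)` is fixed by `α`, then so is `x`: iterating `α` gives `x = x (x⁻¹ α(x)) ^ n`. -/
theorem IsPGroup.fixed_of_fixed {R : Type*} [Group R] {p : ℕ} (hR : IsPGroup p R) {α : R →* R} {n : ℕ} (hn : p.Coprime n)
    (hα : ∀ x, α^[n] x = x) {x : R} (hx : α (x⁻¹ * α x) = x⁻¹ * α x) : α x = x := by
  set d := x⁻¹ * α x with hd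
  have h1 : α x = x * d := by rw [hd]; group
  have h2 : ∀ k, α^[k] x = x * d ^ k := by
    intro k
    induction k with
    | zero => simp
    | succ k ih => rw [Function.iterate_succ_apply', ih, map_mul, map_pow, hx, h1, pow_succ',
        mul_assoc]
  have h3 : d ^ n = 1 := by
    have := h2 n
    rw [hα] at this
    exact (left_eq_mul.1 this)
  have h4 : d = 1 := by
    rw [← orderOf_eq_one_iff]
    exact Nat.dvd_one.1 ((hR.orderOf_coprime hn d) ▸ Nat.dvd_gcd dvd_rfl (orderOf_dvd_of_pow_eq_one h3))
  rw [h1, h4, mul_one]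

theorem mul_pow_of_commutator_mem_center {R : Type*} [Group R] {x d : R} (h : ⁅d, x⁆ ∈ Subgroup.center R) (k : ℕ) :
    (x * d) ^ k = x ^ k * d ^ k * ⁅d, x⁆ ^ k.choose 2 := by
  set c := ⁅d, x⁆ with hc
  have hcen : ∀ g, Commute c g := fun g => (Subgroup.mem_center_iff.1 h g).symm
  have h1 : d * x = c * x * d := by rw [hc, commutatorElement_def]; group
  have h2 : ∀ k : ℕ, d ^ k * x = c ^ k * (x * d ^ k) := by
    intro k
    induction k with
    | zero => simp
    | succ k ih =>
      rw [pow_succ', mul_assoc, ih, ← mul_assoc, ((hcen d).pow_left k).symm.eq, mul_assoc,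
        ← mul_assoc d x, h1, pow_succ c]
      simp only [mul_assoc]
  induction k with
  | zero => simp
  | succ k ih =>
    rw [pow_succ, ih, mul_assoc, ((hcen (x * d)).pow_left _).eq, mul_assoc (x ^ k),
      ← mul_assoc (d ^ k), ← mul_assoc (d ^ k), h2, Nat.choose_succ_succ' k 1, Nat.choose_one_right,
      pow_add c, pow_succ x, pow_succ d]
    have e1 := ((hcen (x * d ^ k * d)).pow_left k).eq
    calc x ^ k * (c ^ k * (x * d ^ k) * d * c ^ k.choose 2)
        = x ^ k * ((c ^ k * (x * d ^ k * d)) * c ^ k.choose 2) := by simp only [mul_assoc]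
      _ = _ := by rw [e1]; simp only [mul_assoc]

section

variable {R : Type*} [Group R] {p : ℕ} [hp : Fact p.Prime]

theorem IsPGroup.normal_of_index_eq_prime [Finite R] (hR : IsPGroup p R) {M : Subgroup R}
    (hM : M.index = p) : M.Normal := by
  have := hR.isNilpotent
  refine Subgroup.NormalizerCondition.normal_of_coatom M (Group.normalizerCondition_of_isNilpotent) ?_
  refine ⟨fun h => ?_, fun K hK => ?_⟩
  · rw [h, Subgroup.index_top] at hM
    exact hp.out.one_lt.ne hM
  · rcases (Nat.dvd_prime hp.out).1 (hM ▸ Subgroup.index_dvd_of_le hK.le) with h | h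
    · exact Subgroup.index_eq_one.1 h
    · have := Subgroup.index_strictAnti hK
      omega

/-- The `p`-th powers and the commutators of a nontrivial `p`-group generate a proper subgroup:
they lie in every subgroup of index `p`. -/
theorem IsPGroup.exists_proper [Finite R] [Nontrivial R] (hR : IsPGroup p R) :
    ∃ M : Subgroup R, M ≠ ⊤ ∧ (∀ x : R, x ^ p ∈ M) ∧ ∀ x y : R, ⁅x, y⁆ ∈ M := by
  obtain ⟨n, hn, hcard⟩ := hR.nontrivial_iff_card.1 inferInstance
  obtain ⟨M, hM⟩ := Sylow.exists_subgroup_card_pow_prime p (n := n - 1) (G := R)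
    (hcard ▸ pow_dvd_pow p (Nat.sub_le n 1))
  have hidx : M.index = p := by
    have := M.card_mul_index
    rw [hM, hcard] at this
    have h2 : p ^ n = p ^ (n - 1) * p := by rw [← pow_succ, Nat.sub_add_cancel hn]
    rw [h2] at this
    exact Nat.eq_of_mul_eq_mul_left (pow_pos hp.out.pos _) this
  have := hR.normal_of_index_eq_prime hidx
  have hq : Nat.card (R ⧸ M) = p := hidx
  have := isCyclic_of_prime_card hq
  refine ⟨M, fun h => ?_, fun x => ?_, fun x y => ?_⟩
  · rw [h, Subgroup.index_top] at hidx
    exact hp.out.one_lt.ne hidx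
  · rw [← QuotientGroup.eq_one_iff, QuotientGroup.mk_pow, ← hq]
    exact pow_card_eq_one'
  · rw [← QuotientGroup.eq_one_iff]
    change QuotientGroup.mk' M ⁅x, y⁆ = 1
    rw [map_commutatorElement, commutatorElement_eq_one_iff_mul_comm]
    let _ := IsCyclic.commGroup (α := R ⧸ M)
    exact mul_comm _ _

end

section

variable {R : Type*} [Group R]

theorem commutator_mul_left_of_mem_center {x y z : R} (h : ⁅y, z⁆ ∈ Subgroup.center R) :
    ⁅x * y, z⁆ = ⁅x, z⁆ * ⁅y, z⁆ := by
  have h1 := Subgroup.mem_center_iff.1 h x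
  calc ⁅x * y, z⁆ = x * ⁅y, z⁆ * z * x⁻¹ * z⁻¹ := by
        simp only [commutatorElement_def]; group
    _ = ⁅y, z⁆ * ⁅x, z⁆ := by rw [h1]; simp only [commutatorElement_def]; group
    _ = ⁅x, z⁆ * ⁅y, z⁆ := (Subgroup.mem_center_iff.1 h _).symm

theorem commutator_pow_left_of_mem_center (h : ∀ x y : R, ⁅x, y⁆ ∈ Subgroup.center R) (x z : R)
    (k : ℕ) : ⁅x ^ k, z⁆ = ⁅x, z⁆ ^ k := by
  induction k with
  | zero => simp
  | succ k ih => rw [pow_succ, commutator_mul_left_of_mem_center (h _ _), ih, pow_succ]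

/-- If the endomorphism `α` fixes all conjugates of `f`, and `R` is generated by the elements
`x⁻¹ α(x)`, then `f` is central. -/
theorem mem_center_of_fixed_conj {α : R →* R}
    (hgen : Subgroup.closure (Set.range fun x : R => x⁻¹ * α x) = ⊤) {f : R}
    (hf : ∀ x, α (x * f * x⁻¹) = x * f * x⁻¹) : f ∈ Subgroup.center R := by
  have hf1 : α f = f := by simpa using hf 1
  have h : Subgroup.closure (Set.range fun x : R => x⁻¹ * α x) ≤ Subgroup.centralizer {f} := by
    rw [Subgroup.closure_le]
    rintro _ ⟨x, rfl⟩
    refine Subgroup.mem_centralizer_singleton_iff.2 ?_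
    have h1 := hf x
    rw [map_mul, map_mul, map_inv, hf1] at h1
    change x⁻¹ * α x * f = f * (x⁻¹ * α x)
    calc x⁻¹ * α x * f = x⁻¹ * (α x * f * (α x)⁻¹) * α x := by group
      _ = f * (x⁻¹ * α x) := by rw [h1]; group
  rw [hgen] at h
  rw [Subgroup.mem_center_iff]
  exact fun g => Subgroup.mem_centralizer_singleton_iff.1 (h (Subgroup.mem_top g))

/-- The commutator subgroup of `R` is central, fixed by `α` and of exponent `2`, and it contains all
squares. Let `N` be a subgroup of it that is maximal among those missing a nontrivial commutator.
If the elements with square outside `N` generate `R`, then two of them do not commute modulo `N`,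
and they generate a quaternion group. Otherwise they are fixed by `α`, hence central, and so
everything is fixed. -/
theorem not_isQuaternionFree_of_not_fixed [Finite R] {α : R →* R}
    (hmin : ∀ L : Subgroup R, (∀ x ∈ L, α x ∈ L) → L ≠ ⊤ → ∀ x ∈ L, α x = x)
    (hgen : Subgroup.closure (Set.range fun x : R => x⁻¹ * α x) = ⊤)
    (hcen : ∀ x y : R, ⁅x, y⁆ ∈ Subgroup.center R) (hcsq : ∀ x y : R, ⁅x, y⁆ ^ 2 = 1)
    (hfix : ∀ x y : R, α ⁅x, y⁆ = ⁅x, y⁆) (hsq : ∀ x, (x⁻¹ * α x) ^ 2 ∈ commutator R)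
    (hne : ∃ x y : R, ⁅x, y⁆ ≠ 1) (hα : ∃ x, α x ≠ x) : ¬ IsQuaternionFree R := by
  intro hQ
  have hmem : ∀ x y : R, ⁅x, y⁆ ∈ commutator R := fun x y =>
    Subgroup.commutator_mem_commutator (Subgroup.mem_top x) (Subgroup.mem_top y)
  have hDcen : commutator R ≤ Subgroup.center R := by
    rw [commutator_eq_closure, Subgroup.closure_le]
    rintro _ ⟨x, y, rfl⟩
    exact hcen x y
  have hcomm : ∀ c ∈ commutator R, ∀ g, c * g = g * c := fun c hc g =>
    (Subgroup.mem_center_iff.1 (hDcen hc) g).symm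
  have hDsq : ∀ c ∈ commutator R, c ^ 2 = 1 := by
    intro c hc
    rw [commutator_eq_closure] at hc
    induction hc using Subgroup.closure_induction with
    | mem c h => obtain ⟨x, y, rfl⟩ := h; exact hcsq x y
    | one => exact one_pow 2
    | mul a b ha _ iha ihb =>
      rw [← commutator_eq_closure] at ha
      rw [Commute.mul_pow (hcomm a ha b), iha, ihb, one_mul]
    | inv a _ iha => rw [inv_pow, iha, inv_one]
  have hDfix : ∀ c ∈ commutator R, α c = c := by
    intro c hc
    rw [commutator_eq_closure] at hc
    induction hc using Subgroup.closure_induction with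
    | mem c h => obtain ⟨x, y, rfl⟩ := h; exact hfix x y
    | one => exact map_one α
    | mul a b _ _ iha ihb => rw [map_mul, iha, ihb]
    | inv a _ iha => rw [map_inv, iha]
  have hmulsq : ∀ x y : R, (x * y) ^ 2 = x ^ 2 * y ^ 2 * ⁅y, x⁆ := fun x y => by
    have := mul_pow_of_commutator_mem_center (hcen y x) 2
    rwa [Nat.choose_self, pow_one] at this
  have hRsq : ∀ x : R, x ^ 2 ∈ commutator R := by
    intro x
    have hx : x ∈ Subgroup.closure (Set.range fun x : R => x⁻¹ * α x) := by
      rw [hgen]; exact Subgroup.mem_top x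
    induction hx using Subgroup.closure_induction with
    | mem c h => obtain ⟨x, rfl⟩ := h; exact hsq x
    | one => rw [one_pow]; exact one_mem _
    | mul a b _ _ iha ihb => rw [hmulsq]; exact mul_mem (mul_mem iha ihb) (hmem b a)
    | inv a _ iha => rw [inv_pow]; exact inv_mem iha
  obtain ⟨x₁, y₁, hz⟩ := hne
  set z := ⁅x₁, y₁⁆ with hzdef
  have hzD : z ∈ commutator R := hmem x₁ y₁
  obtain ⟨N, ⟨hND, hzN⟩, hNmax⟩ :=
    (Set.toFinite {N : Subgroup R | N ≤ commutator R ∧ z ∉ N}).exists_maximal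
      ⟨⊥, bot_le, fun h => hz (Subgroup.mem_bot.1 h)⟩
  have hNn : N.Normal := ⟨fun a ha g => by
    rwa [← hcomm a (hND ha) g, mul_assoc, mul_inv_cancel, mul_one]⟩
  -- `N` has index `2` in the commutator subgroup, the other coset being that of `z`
  have hcoset : ∀ b ∈ commutator R, b ∉ N → b * z ∈ N := by
    intro b hb hbN
    have hN' : z ∈ N ⊔ Subgroup.zpowers b := by
      by_contra hcon
      exact hbN (hNmax ⟨sup_le hND (Subgroup.zpowers_le.2 hb), hcon⟩ le_sup_left
        (Subgroup.mem_sup_right (Subgroup.mem_zpowers b)))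
    obtain ⟨m, hm, c, hc, hmc⟩ := Subgroup.mem_sup_of_normal_left.1 hN'
    obtain ⟨k, rfl⟩ := Subgroup.mem_zpowers_iff.1 hc
    have hb2 : b ^ (2 : ℤ) = 1 := by rw [zpow_ofNat, hDsq b hb]
    rcases Int.even_or_odd' k with ⟨j, rfl | rfl⟩
    · rw [zpow_mul, hb2, one_zpow, mul_one] at hmc
      exact absurd (hmc ▸ hm) hzN
    · rw [zpow_add, zpow_mul, hb2, one_zpow, one_mul, zpow_one] at hmc
      rw [← hmc, ← mul_assoc, hcomm b hb m, mul_assoc, ← sq, hDsq b hb, mul_one]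
      exact hm
  let q := QuotientGroup.mk' N
  have hq : ∀ g, q g = 1 ↔ g ∈ N := fun g => QuotientGroup.eq_one_iff g
  have hqz2 : q z ^ 2 = 1 := by rw [← map_pow, hDsq z hzD, map_one]
  have hqD : ∀ b ∈ commutator R, b ∉ N → q b = q z := by
    intro b hb hbN
    have := (hq _).2 (hcoset b hb hbN)
    rw [map_mul] at this
    rw [eq_inv_of_mul_eq_one_left this]
    exact inv_eq_of_mul_eq_one_left (by rw [← sq, hqz2])
  have hqcomm : ∀ x y, ⁅x, y⁆ ∈ N ↔ Commute (q x) (q y) := fun x y => by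
    rw [← hq, map_commutatorElement, commutatorElement_eq_one_iff_mul_comm]; rfl
  let S : Set R := {x | x ^ 2 ∉ N}
  have hSα : ∀ x ∈ Subgroup.closure S, α x ∈ Subgroup.closure S := by
    have : Subgroup.closure S ≤ (Subgroup.closure S).comap α := by
      rw [Subgroup.closure_le]
      intro x hx
      refine Subgroup.subset_closure ?_
      change (α x) ^ 2 ∉ N
      rw [← map_pow, hDfix _ (hRsq x)]
      exact hx
    exact this
  by_cases hST : Subgroup.closure S = ⊤
  · by_cases hnc : ∃ x ∈ S, ∃ y ∈ S, ⁅x, y⁆ ∉ N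
    · obtain ⟨x, hx, y, hy, hxy⟩ := hnc
      have h1 := hqD _ (hmem x y) hxy
      have hxy' : q x * q y = q z * (q y * q x) := by
        rw [← h1, map_commutatorElement, commutatorElement_def]
        group
      obtain ⟨φ, hφ⟩ := exists_quaternionGroup_hom (x := q x) (y := q y) (z := q z)
        (by rw [← map_pow]; exact hqD _ (hRsq x) hx)
        (by rw [← map_pow]; exact hqD _ (hRsq y) hy) hqz2
        (fun h => hzN ((hq z).1 h)) hxy'
      exact not_isQuaternionFree_of_quotient N φ hφ hQ
    · push Not at hnc
      -- the generators commute modulo `N`, so `N` contains all commutators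
      have h1 : ∀ x ∈ S, ∀ y, Commute (q x) (q y) := by
        intro x hx y
        have : Subgroup.closure S ≤ (Subgroup.centralizer {q x}).comap q := by
          rw [Subgroup.closure_le]
          intro y hy
          exact Subgroup.mem_centralizer_singleton_iff.2 ((hqcomm x y).1 (hnc x hx y hy)).symm.eq
        rw [hST] at this
        exact (show Commute (q y) (q x) from
          Subgroup.mem_centralizer_singleton_iff.1 (this (Subgroup.mem_top y))).symm
      have h2 : Commute (q x₁) (q y₁) := by
        have : Subgroup.closure S ≤ (Subgroup.centralizer {q y₁}).comap q := by
          rw [Subgroup.closure_le]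
          intro x hx
          exact Subgroup.mem_centralizer_singleton_iff.2 (h1 x hx y₁).eq
        rw [hST] at this
        exact Subgroup.mem_centralizer_singleton_iff.1 (this (Subgroup.mem_top x₁))
      exact hzN ((hqcomm x₁ y₁).2 h2)
  · have hSfix : ∀ s ∈ S, α s = s := fun s hs =>
      hmin _ hSα hST s (Subgroup.subset_closure hs)
    have hScen : ∀ s ∈ S, s ∈ Subgroup.center R := fun s hs => by
      refine mem_center_of_fixed_conj hgen fun x => ?_
      have : x * s * x⁻¹ = ⁅x, s⁆ * s := by rw [commutatorElement_def]; group
      rw [this, map_mul, hfix, hSfix s hs]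
    have hSne : ∃ s, s ∈ S := by
      by_contra hcon
      have hall : ∀ x, x ^ 2 ∈ N := fun x => by
        by_contra hx
        exact hcon ⟨x, hx⟩
      have h1 := hmulsq y₁ x₁
      have h2 := (Subgroup.mul_mem_cancel_left N (mul_mem (hall y₁) (hall x₁))).1 (h1 ▸ hall (y₁ * x₁))
      exact hzN h2
    obtain ⟨s, hs⟩ := hSne
    obtain ⟨x, hx⟩ := hα
    by_cases hxS : x ∈ S
    · exact hx (hSfix x hxS)
    · have hxN : x ^ 2 ∈ N := not_not.1 hxS
      have hxs : x * s ∈ S := by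
        change (x * s) ^ 2 ∉ N
        rw [Commute.mul_pow (Subgroup.mem_center_iff.1 (hScen s hs) x),
          Subgroup.mul_mem_cancel_left N hxN]
        exact hs
      have := hSfix _ hxs
      rw [map_mul, hSfix s hs] at this
      exact hx (mul_right_cancel this)

variable {p : ℕ} [hp : Fact p.Prime]

/-- The minimal case of `IsPGroup.fixed_of_fixed_of_pow_eq_one`: every proper invariant subgroup
is fixed pointwise. Then `p`-th powers and commutators are central and fixed, so that
`(x d) ^ p = α(x) ^ p = x ^ p` for `d = x⁻¹ α(x)` forces `d ^ p = 1` (or `d ^ 4 = 1` if `p = 2`). -/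
theorem IsPGroup.fixed_of_minimal [Finite R] (hR : IsPGroup p R) {α : R →* R} {n : ℕ}
    (hn : p.Coprime n) (hα : ∀ x, α^[n] x = x)
    (hmin : ∀ L : Subgroup R, (∀ x ∈ L, α x ∈ L) → L ≠ ⊤ → ∀ x ∈ L, α x = x)
    (h1 : ∀ x, x ^ p = 1 → α x = x)
    (h2 : p = 2 → (∀ x, x ^ 4 = 1 → α x = x) ∨ IsQuaternionFree R) (x : R) : α x = x := by
  by_contra hx
  have hδ : ∀ x, α (x⁻¹ * α x) = x⁻¹ * α x → α x = x := fun x h =>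
    hR.fixed_of_fixed hn hα h
  have hgen : Subgroup.closure (Set.range fun x : R => x⁻¹ * α x) = ⊤ := by
    by_contra hcon
    refine hx (hδ x (hmin _ ?_ hcon _ (Subgroup.subset_closure ⟨x, rfl⟩)))
    have : Subgroup.closure (Set.range fun x : R => x⁻¹ * α x) ≤
        (Subgroup.closure (Set.range fun x : R => x⁻¹ * α x)).comap α := by
      rw [Subgroup.closure_le]
      rintro _ ⟨y, rfl⟩
      refine Subgroup.subset_closure ⟨α y, ?_⟩
      change _ = α (y⁻¹ * α y)
      rw [map_mul, map_inv]
    exact this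
  have : Nontrivial R := ⟨⟨α x, x, hx⟩⟩
  let F : Set R := (Set.range fun x : R => x ^ p) ∪ Set.range fun y : R × R => ⁅y.1, y.2⁆
  have hFpow : ∀ x : R, x ^ p ∈ F := fun x => .inl ⟨x, rfl⟩
  have hFcomm : ∀ x y : R, ⁅x, y⁆ ∈ F := fun x y => .inr ⟨(x, y), rfl⟩
  have hFmap : ∀ (f : R →* R), ∀ x ∈ F, f x ∈ F := by
    rintro f _ (⟨x, rfl⟩ | ⟨⟨x, y⟩, rfl⟩)
    · change f (x ^ p) ∈ F
      rw [map_pow]; exact hFpow _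
    · change f ⁅x, y⁆ ∈ F
      rw [map_commutatorElement]; exact hFcomm _ _
  have hFfix : ∀ x ∈ F, α x = x := by
    obtain ⟨M, hM, hMp, hMc⟩ := hR.exists_proper
    refine fun x hx => hmin (Subgroup.closure F) ?_ (fun h => hM ?_) x (Subgroup.subset_closure hx)
    · have : Subgroup.closure F ≤ (Subgroup.closure F).comap α := by
        rw [Subgroup.closure_le]
        exact fun y hy => Subgroup.subset_closure (hFmap α y hy)
      exact this
    · rw [← top_le_iff, ← h, Subgroup.closure_le]
      rintro _ (⟨x, rfl⟩ | ⟨⟨x, y⟩, rfl⟩)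
      · exact hMp x
      · exact hMc x y
  have hFcen : ∀ x ∈ F, x ∈ Subgroup.center R := fun f hf =>
    mem_center_of_fixed_conj hgen fun x => hFfix _ (hFmap (MulAut.conj x).toMonoidHom f hf)
  have hcen : ∀ x y : R, ⁅x, y⁆ ∈ Subgroup.center R := fun x y => hFcen _ (hFcomm x y)
  have hcp : ∀ x y : R, ⁅x, y⁆ ^ p = 1 := fun x y => by
    rw [← commutator_pow_left_of_mem_center hcen, commutatorElement_eq_one_iff_mul_comm]
    exact (Subgroup.mem_center_iff.1 (hFcen _ (hFpow x)) y).symm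
  have key : ∀ x, (x⁻¹ * α x) ^ p * ⁅x⁻¹ * α x, x⁆ ^ p.choose 2 = 1 := fun x => by
    have e1 := mul_pow_of_commutator_mem_center (x := x) (d := x⁻¹ * α x) (hcen _ _) p
    rw [mul_inv_cancel_left, ← map_pow, hFfix _ (hFpow x), mul_assoc] at e1
    exact left_eq_mul.1 e1
  rcases hp.out.eq_two_or_odd' with rfl | hodd
  · have hsq : ∀ x, (x⁻¹ * α x) ^ 2 = ⁅x⁻¹ * α x, x⁆ := fun x => by
      have e1 := key x
      rw [Nat.choose_self, pow_one] at e1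
      rw [eq_inv_of_mul_eq_one_left e1]
      exact inv_eq_of_mul_eq_one_left (by rw [← sq, hcp])
    rcases h2 rfl with h4 | hQ
    · refine hx (hδ x (h4 _ ?_))
      rw [show 4 = 2 * 2 from rfl, pow_mul, hsq, hcp]
    · refine not_isQuaternionFree_of_not_fixed hmin hgen hcen hcp (fun x y => hFfix _ (hFcomm x y))
        (fun x => ?_) ?_ ⟨x, hx⟩ hQ
      · rw [hsq]
        exact Subgroup.commutator_mem_commutator (Subgroup.mem_top _) (Subgroup.mem_top _)
      · by_contra hcon
        push Not at hcon
        exact hx (hδ x (h1 _ (by rw [hsq, hcon])))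
  · have hdvd : p ∣ p.choose 2 :=
      hp.out.dvd_choose_self two_ne_zero
        (lt_of_le_of_ne hp.out.two_le fun h => by rw [← h] at hodd; exact absurd hodd (by decide))
    obtain ⟨k, hk⟩ := hdvd
    refine hx (hδ x (h1 _ ?_))
    have := key x
    rwa [hk, pow_mul, hcp, one_pow, mul_one] at this

end

/-- An endomorphism of a finite `p`-group whose order is prime to `p` is trivial as soon as it fixes
the elements of order `p` and, if `p = 2` and the group is not quaternion-free, those of
order `4`. -/
theorem IsPGroup.fixed_of_fixed_of_pow_eq_one {p : ℕ} [hp : Fact p.Prime] {n : ℕ}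
    (hn : p.Coprime n) {R : Type*} [Group R] [Finite R] (hR : IsPGroup p R) {α : R →* R}
    (hα : ∀ x, α^[n] x = x) (h1 : ∀ x, x ^ p = 1 → α x = x)
    (h2 : p = 2 → (∀ x, x ^ 4 = 1 → α x = x) ∨ IsQuaternionFree R) (x : R) : α x = x := by
  have key : ∀ (m : ℕ) (L : Subgroup R), Nat.card L = m → (∀ x ∈ L, α x ∈ L) →
      ∀ x ∈ L, α x = x := by
    intro m
    induction m using Nat.strong_induction_on with
    | _ m ih =>
      intro L hL hinv x hx
      let β : L →* L := (α.comp L.subtype).codRestrict L fun x => hinv x x.2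
      have hβ : ∀ x : L, ((β x : L) : R) = α x := fun x => rfl
      have hβn : ∀ (k : ℕ) (x : L), ((β^[k] x : L) : R) = α^[k] x := by
        intro k
        induction k with
        | zero => exact fun x => rfl
        | succ k ihk => intro x; rw [Function.iterate_succ_apply', Function.iterate_succ_apply',
            hβ, ihk]
      have hfin := IsPGroup.fixed_of_minimal (hR.to_subgroup L) (α := β) hn
        (fun x => Subtype.ext (by rw [hβn, hα])) ?_
        (fun x hx => Subtype.ext (h1 x (by rw [← L.coe_pow, hx, L.coe_one]))) ?_ ⟨x, hx⟩
      · exact congrArg Subtype.val hfin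
      · intro K hK hKtop y hy
        refine Subtype.ext (ih (Nat.card (K.map L.subtype)) ?_ (K.map L.subtype) rfl ?_ y
          (Subgroup.mem_map_of_mem L.subtype hy))
        · rw [← hL, Subgroup.card_map_of_injective L.subtype_injective]
          exact lt_of_le_of_ne (Subgroup.card_le_card_group K)
            fun h => hKtop (Subgroup.eq_top_of_card_eq K h)
        · rintro _ ⟨w, hw, rfl⟩
          exact ⟨β w, hK w hw, rfl⟩
      · intro h
        rcases h2 h with h4 | hQ
        · exact .inl fun x hx => Subtype.ext (h4 x (by rw [← L.coe_pow, hx, L.coe_one]))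
        · exact .inr (hQ.of_injective L.subtype L.subtype_injective)
  exact key _ ⊤ rfl (fun _ _ => Subgroup.mem_top _) x (Subgroup.mem_top x)

/-! ### Chief factors of `p`-power order -/

section

variable {G : Type*} [Group G]

/-- The centralizer in `G` of the factor `A / B`: the elements `g` with `[g, A] ≤ B`. It is encoded
as the preimage of the centralizer of the image of `A` in `G ⧸ B`. -/
def factorCentralizer (A B : Subgroup G) [B.Normal] : Subgroup G :=
  (Subgroup.centralizer (A.map (QuotientGroup.mk' B) : Set (G ⧸ B))).comap (QuotientGroup.mk' B)

theorem commute_mk_iff {B : Subgroup G} [B.Normal] {g a : G} :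
    Commute (QuotientGroup.mk' B g) (QuotientGroup.mk' B a) ↔ ⁅g, a⁆ ∈ B := by
  rw [← QuotientGroup.eq_one_iff (N := B)]
  change _ ↔ QuotientGroup.mk' B ⁅g, a⁆ = 1
  rw [map_commutatorElement, commutatorElement_eq_one_iff_mul_comm]
  rfl

theorem mem_factorCentralizer {A B : Subgroup G} [B.Normal] {g : G} :
    g ∈ factorCentralizer A B ↔ ∀ a ∈ A, ⁅g, a⁆ ∈ B := by
  simp only [← commute_mk_iff]
  constructor
  · exact fun h a ha => (Subgroup.mem_centralizer_iff.1 h _ (Subgroup.mem_map_of_mem _ ha)).symm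
  · intro h
    refine Subgroup.mem_centralizer_iff.2 ?_
    rintro _ ⟨a, ha, rfl⟩
    exact (h a ha).symm

instance factorCentralizer_normal (A B : Subgroup G) [A.Normal] [B.Normal] :
    (factorCentralizer A B).Normal := by
  have : (A.map (QuotientGroup.mk' B)).Normal :=
    Subgroup.Normal.map inferInstance _ (QuotientGroup.mk'_surjective B)
  unfold factorCentralizer
  infer_instance

variable [Finite G] {p : ℕ} [hp : Fact p.Prime]

theorem isPGroup_of_forall_coprime_orderOf
    (h : ∀ g : G, p.Coprime (orderOf g) → g = 1) : IsPGroup p G := by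
  rw [isPGroup_iff_primeFactors_card_subset hp.out.ne_zero]
  intro q hq
  have hqp := Nat.prime_of_mem_primeFactors hq
  have := Fact.mk hqp
  obtain ⟨g, hg⟩ := exists_prime_orderOf_dvd_card' (G := G) q (Nat.dvd_of_mem_primeFactors hq)
  by_contra hne
  rw [hp.out.primeFactors, Finset.mem_singleton] at hne
  have h1 := h g (hg ▸ (Nat.coprime_primes hp.out hqp).2 (Ne.symm hne))
  rw [h1, orderOf_one] at hg
  exact hqp.one_lt.ne hg

theorem IsPGroup.eq_one_of_coprime {G : Type*} [Group G] {p : ℕ} (hG : IsPGroup p G) {g : G}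
    (h : p.Coprime (orderOf g)) : g = 1 :=
  orderOf_eq_one_iff.1 ((Nat.coprime_self _).1 (hG.orderOf_coprime h g))

/-- A `p`-subgroup has a nontrivial fixed point on any normal factor of `p`-power order. -/
theorem exists_commutator_mem {A B : Subgroup G} [A.Normal] [B.Normal] (hBA : B < A) {n : ℕ}
    (hidx : B.relIndex A = p ^ n) {P : Subgroup G} (hP : IsPGroup p P) :
    ∃ a ∈ A, a ∉ B ∧ ∀ u ∈ P, ⁅u, a⁆ ∈ B := by
  have hAn : (A.map (QuotientGroup.mk' B)).Normal :=
    Subgroup.Normal.map inferInstance _ (QuotientGroup.mk'_surjective B)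
  let _ : MulAction P (A.map (QuotientGroup.mk' B)) :=
    MulAction.compHom (A.map (QuotientGroup.mk' B))
      ((MulAut.conjNormal (H := A.map (QuotientGroup.mk' B))).comp ((QuotientGroup.mk' B).comp P.subtype))
  have hact : ∀ (u : P) (b : A.map (QuotientGroup.mk' B)),
      ((u • b : A.map (QuotientGroup.mk' B)) : G ⧸ B) =
        QuotientGroup.mk' B u * b * (QuotientGroup.mk' B u)⁻¹ := fun u b => rfl
  have hcard : p ∣ Nat.card (A.map (QuotientGroup.mk' B)) := by
    rw [← Subgroup.relIndex_ker, QuotientGroup.ker_mk', hidx]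
    refine dvd_pow_self p fun h => ?_
    rw [h, pow_zero] at hidx
    exact hBA.not_ge (Subgroup.relIndex_eq_one.1 hidx)
  obtain ⟨b, hb, hb1⟩ := hP.exists_fixed_point_of_prime_dvd_card_of_fixed_point _ hcard
    (a := (1 : A.map (QuotientGroup.mk' B))) (fun u => Subtype.ext (by rw [hact]; simp))
  obtain ⟨_, a, ha, rfl⟩ := b
  refine ⟨a, ha, fun h => hb1 (Subtype.ext ((QuotientGroup.eq_one_iff a).2 h).symm),
    fun u hu => ?_⟩
  rw [← commute_mk_iff]
  have := congrArg Subtype.val (hb ⟨u, hu⟩)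
  rw [hact] at this
  exact mul_inv_eq_iff_eq_mul.1 this

/-- A chief factor of `p`-power order that is centralized, up to a `p`-subgroup, by all of `G` has
order `p`. -/
theorem IsChiefFactor.relIndex_eq_prime {H K : Subgroup G} (h : IsChiefFactor H K) {n : ℕ}
    (hidx : H.relIndex K = p ^ n) {P : Subgroup G} (hP : IsPGroup p P)
    (hgen : ∀ L : Subgroup G, P ≤ L → (∀ g, (∀ a ∈ K, ⁅g, a⁆ ∈ H) → g ∈ L) → L = ⊤) :
    H.relIndex K = p := by
  have := h.normal_bot
  have := h.normal_top
  obtain ⟨a, haK, haH, ha⟩ := exists_commutator_mem h.lt hidx hP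
  let q := QuotientGroup.mk' H
  have hqa : q a ≠ 1 := fun h => haH ((QuotientGroup.eq_one_iff a).1 h)
  have hcen : ∀ x, Commute x (q a) := by
    have htop : (Subgroup.centralizer {q a}).comap q = ⊤ := by
      refine hgen _ (fun u hu => ?_) (fun g hg => ?_)
      · exact Subgroup.mem_centralizer_singleton_iff.2 (commute_mk_iff.2 (ha u hu))
      · exact Subgroup.mem_centralizer_singleton_iff.2 (commute_mk_iff.2 (hg a haK))
    intro x
    obtain ⟨g, rfl⟩ := QuotientGroup.mk'_surjective H x
    have : g ∈ (Subgroup.centralizer {q a}).comap q := by rw [htop]; exact Subgroup.mem_top g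
    exact Subgroup.mem_centralizer_singleton_iff.1 this
  have hmap : H.relIndex K = Nat.card (K.map q) := by
    rw [← Subgroup.relIndex_ker, QuotientGroup.ker_mk']
  have hKp : IsPGroup p (K.map q) := IsPGroup.of_card (hmap.symm.trans hidx)
  have hpo : p ∣ orderOf (q a) := by
    have := hKp.dvd_orderOf (g := ⟨q a, Subgroup.mem_map_of_mem q haK⟩)
      (fun h => hqa (congrArg Subtype.val h))
    rwa [← Subgroup.orderOf_coe] at this
  set b := q a ^ (orderOf (q a) / p) with hb
  have hbo : orderOf b = p := orderOf_pow_orderOf_div (orderOf_pos (q a)).ne' hpo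
  have hbcen : ∀ x, Commute x b := fun x => (hcen x).pow_right _
  have hbn : (Subgroup.zpowers b).Normal := ⟨fun y hy g => by
    obtain ⟨k, rfl⟩ := Subgroup.mem_zpowers_iff.1 hy
    rwa [((hbcen g).zpow_right k).eq, mul_inv_cancel_right]⟩
  have hbK : b ∈ K.map q := pow_mem (Subgroup.mem_map_of_mem q haK) _
  rcases h.eq_or_eq ((Subgroup.zpowers b).comap q) (hbn.comap q)
    (fun x hx => by
      change q x ∈ Subgroup.zpowers b
      rw [show q x = 1 from (QuotientGroup.eq_one_iff x).2 hx]; exact one_mem _)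
    (by
      have h1 : (K.map q).comap q = K := by
        rw [Subgroup.comap_map_eq, QuotientGroup.ker_mk', sup_eq_left.2 h.lt.le]
      exact h1 ▸ Subgroup.comap_mono (Subgroup.zpowers_le.2 hbK)) with h1 | h1
  · exfalso
    obtain ⟨c, hc⟩ := QuotientGroup.mk'_surjective H b
    have hcH : c ∈ H := by
      rw [← h1]
      change q c ∈ Subgroup.zpowers b
      rw [show q c = b from hc]; exact Subgroup.mem_zpowers b
    have : b = 1 := hc ▸ (QuotientGroup.eq_one_iff c).2 hcH
    rw [this, orderOf_one] at hbo
    exact hp.out.one_lt.ne hbo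
  · rw [hmap, ← h1, Subgroup.map_comap_eq_self_of_surjective (QuotientGroup.mk'_surjective H),
      Nat.card_zpowers, hbo]

theorem IsPGroup.le_factorCentralizer {A B : Subgroup G} [A.Normal] [B.Normal] (hBA : B ≤ A)
    (hidx : B.relIndex A ∣ p) {P : Subgroup G} (hP : IsPGroup p P) : P ≤ factorCentralizer A B := by
  rcases hBA.eq_or_lt with rfl | hlt
  · exact fun u _ => mem_factorCentralizer.2 fun a ha =>
      B.mul_mem (‹B.Normal›.conj_mem a ha u) (inv_mem ha)
  have hidx' : B.relIndex A = p ^ 1 := by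
    rw [pow_one]
    exact ((Nat.dvd_prime hp.out).1 hidx).resolve_left
      fun h => hlt.not_ge (Subgroup.relIndex_eq_one.1 h)
  obtain ⟨a, haA, haB, ha⟩ := exists_commutator_mem hlt hidx' hP
  let D := A ⊓ (Subgroup.centralizer (P.map (QuotientGroup.mk' B) : Set (G ⧸ B))).comap
    (QuotientGroup.mk' B)
  have hD : ∀ x, x ∈ D ↔ x ∈ A ∧ ∀ u ∈ P, ⁅u, x⁆ ∈ B := by
    intro x
    refine and_congr_right fun _ => ?_
    simp only [← commute_mk_iff]
    constructor
    · exact fun h u hu => Subgroup.mem_centralizer_iff.1 h _ (Subgroup.mem_map_of_mem _ hu)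
    · intro h
      refine Subgroup.mem_centralizer_iff.2 ?_
      rintro _ ⟨u, hu, rfl⟩
      exact h u hu
  have hBD : B ≤ D := fun x hx => (hD x).2 ⟨hBA hx, fun u _ =>
    B.mul_mem (‹B.Normal›.conj_mem x hx u) (inv_mem hx)⟩
  have hmul := Subgroup.relIndex_mul_relIndex B D A hBD inf_le_left
  rw [hidx', pow_one] at hmul
  have hAD : A ≤ D := by
    rw [← Subgroup.relIndex_eq_one]
    rcases (Nat.dvd_prime hp.out).1 (Dvd.intro_left _ hmul) with h1 | h1
    · exact h1
    · exfalso
      rw [h1] at hmul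
      have := Nat.eq_of_mul_eq_mul_right hp.out.pos (hmul.trans (one_mul p).symm)
      exact haB (Subgroup.relIndex_eq_one.1 this ((hD a).2 ⟨haA, ha⟩))
  exact fun u hu => mem_factorCentralizer.2 fun x hx => ((hD x).1 (hAD hx)).2 u hu

theorem iterate_conjNormal {G : Type*} [Group G] {N : Subgroup G} [N.Normal] (g : G) (y : N)
    (k : ℕ) : ((MulAut.conjNormal g).toMonoidHom : N →* N)^[k] y = MulAut.conjNormal (g ^ k) y := by
  induction k with
  | zero => simp
  | succ k ih => rw [Function.iterate_succ_apply', ih, pow_succ', map_mul]; rfl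

/-! ### Subgroups with trivial `p'`-core -/

/-- If `P` centralizes the factors of order `p` of a series below `N`, the `p'`-elements of its
normal closure centralize `N`, so they are trivial when `N` contains its centralizer. -/
theorem IsPSupersolvable.sylow_normal (h : IsPSupersolvable p G) {N : Subgroup G} [N.Normal]
    (hN : IsPGroup p N) (hcen : Subgroup.centralizer (N : Set G) ≤ N) (P : Sylow p G) :
    (P : Subgroup G).Normal := by
  have key : ∀ g ∈ Subgroup.normalClosure (P : Set G), p.Coprime (orderOf g) →
      ∀ L : Subgroup G, HasNormalSeries (PSupersolvableIndex p) L →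
        (∀ x ∈ N ⊓ L, g * x = x * g) → ∀ x ∈ N, g * x = x * g := by
    intro g hg hgp L hL
    induction hL with
    | top => exact fun h x hx => h x ⟨hx, Subgroup.mem_top x⟩
    | @step L K hLn hLK hidx hK ih =>
      intro hgL
      refine ih ?_
      have := hK.normal
      have hle : N ⊓ L ≤ N ⊓ K := inf_le_inf_left N hLK
      have hidx' : (N ⊓ L).relIndex (N ⊓ K) ∣ L.relIndex K := Subgroup.inf_relIndex_inf_dvd
      intro x hx
      rcases hidx with h1 | h1
      · have hPC : Subgroup.normalClosure (P : Set G) ≤ factorCentralizer (N ⊓ K) (N ⊓ L) :=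
          Subgroup.normalClosure_le_normal (P.2.le_factorCentralizer hle (hidx'.trans h1))
        have hfix := hN.fixed_of_fixed hgp (α := (MulAut.conjNormal g).toMonoidHom)
          (x := ⟨x, hx.1⟩) ?_ ?_
        · have := congrArg Subtype.val hfix
          exact mul_inv_eq_iff_eq_mul.1 this
        · intro y
          rw [iterate_conjNormal, pow_orderOf_eq_one, map_one]; rfl
        · have hmem := mem_factorCentralizer.1 (hPC hg) x⁻¹ (inv_mem hx)
          have hmem' : x⁻¹ * (g * x * g⁻¹) ∈ N ⊓ L := by
            have := inv_mem hmem
            rw [commutatorElement_inv, commutatorElement_def] at this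
            convert this using 1
            group
          refine Subtype.ext ?_
          change g * (x⁻¹ * (g * x * g⁻¹)) * g⁻¹ = x⁻¹ * (g * x * g⁻¹)
          rw [hgL _ hmem', mul_inv_cancel_right]
      · refine hgL x ?_
        have h2 : (N ⊓ L).relIndex (N ⊓ K) = 1 := by
          have h3 : p.Coprime ((N ⊓ L).relIndex (N ⊓ K)) := h1.coprime_dvd_right hidx'
          obtain ⟨k, hk⟩ := (hN.to_inf_left (K := K)).index ((N ⊓ L).subgroupOf (N ⊓ K))
          change (N ⊓ L).relIndex (N ⊓ K) = p ^ k at hk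
          rw [hk] at h3 ⊢
          rcases Nat.eq_zero_or_pos k with rfl | hk0
          · exact pow_zero p
          · exact absurd ((Nat.coprime_pow_right_iff hk0 p p).1 h3)
              (fun h2 => hp.out.one_lt.ne' ((Nat.coprime_self p).1 h2))
        exact Subgroup.relIndex_eq_one.1 h2 hx
  have hD : IsPGroup p (Subgroup.normalClosure (P : Set G)) := by
    refine isPGroup_of_forall_coprime_orderOf fun g hg => ?_
    rw [← Subgroup.orderOf_coe] at hg
    have hgN : (g : G) ∈ N := by
      refine hcen (Subgroup.mem_centralizer_iff.2 fun x hx => ?_)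
      refine (key g g.2 hg ⊥ (isPSupersolvable_iff.1 h) ?_ x hx).symm
      rintro y ⟨-, hy⟩
      rw [Subgroup.mem_bot.1 hy, mul_one, one_mul]
    have := hN.eq_one_of_coprime (g := ⟨g, hgN⟩) (by rwa [← Subgroup.orderOf_coe])
    exact Subtype.ext (congrArg (Subtype.val : N → G) this)
  have : (P : Subgroup G) = Subgroup.normalClosure (P : Set G) :=
    le_antisymm Subgroup.subset_normalClosure (hD.le_sylow_of_normal P)
  rw [this]
  infer_instance

/-- The Hall–Higman lemma: in a `p`-solvable group without nontrivial normal `p'`-subgroups, the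
largest normal `p`-subgroup contains its centralizer. -/
theorem IsPSolvable.centralizer_le (hG : IsPSolvable p G)
    (hO : ∀ X : Subgroup G, X.Normal → p.Coprime (Nat.card X) → X = ⊥) {N : Subgroup G} [N.Normal]
    (hN : IsPGroup p N) (hmax : ∀ X : Subgroup G, X.Normal → IsPGroup p X → X ≤ N) :
    Subgroup.centralizer (N : Set G) ≤ N := by
  set C := Subgroup.centralizer (N : Set G) with hC
  by_contra hcon
  have hlt : C ⊓ N < C := lt_of_le_of_ne inf_le_left fun h => hcon (inf_eq_left.1 h)
  obtain ⟨L, hL, hLC⟩ := exists_isChiefFactor hlt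
  have hLn := hL.normal_top
  have hZp : IsPGroup p (C ⊓ N : Subgroup G) := hN.to_inf_right
  obtain ⟨k, hk⟩ := IsPGroup.iff_card.1 hZp
  have hcardL : Nat.card (C ⊓ N : Subgroup G) * (C ⊓ N).relIndex L = Nat.card L := by
    rw [← Subgroup.relIndex_bot_left, ← Subgroup.relIndex_bot_left,
      Subgroup.relIndex_mul_relIndex _ _ _ bot_le hL.lt.le]
  rcases hG _ _ hL with ⟨n, hn⟩ | hcop
  · have hLp : IsPGroup p L := IsPGroup.of_card (n := k + n) (by rw [← hcardL, hk, hn, pow_add])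
    exact hL.lt.not_ge (le_inf hLC (hmax L hLn hLp))
  · have hcopZ : Nat.Coprime (Nat.card ((C ⊓ N).subgroupOf L)) ((C ⊓ N).subgroupOf L).index := by
      have h1 : Nat.card ((C ⊓ N).subgroupOf L) = p ^ k := by
        rw [← hk]
        exact Nat.card_congr (Subgroup.subgroupOfEquivOfLe hL.lt.le).toEquiv
      rw [h1]
      exact hcop.pow_left k
    obtain ⟨X, hX⟩ := Subgroup.exists_right_complement'_of_coprime hcopZ
    have hXcard : p.Coprime (Nat.card X) := by
      have := hX.symm.index_eq_card
      rw [← this]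
      exact hcop
    -- the complement consists of the elements of `L` of order prime to `p`, so it is normal in `G`
    have hmem : ∀ l : L, l ∈ X ↔ p.Coprime (orderOf (l : G)) := by
      intro l
      rw [Subgroup.orderOf_coe]
      constructor
      · intro hl
        refine hXcard.coprime_dvd_right ?_
        have := orderOf_dvd_natCard (⟨l, hl⟩ : X)
        rwa [← Subgroup.orderOf_coe] at this
      · intro hl
        obtain ⟨⟨z, x⟩, hzx⟩ := hX.2 l
        simp only at hzx
        have hcomm : Commute (z : L) (x : L) := Subtype.ext
          ((Subgroup.mem_centralizer_iff.1 (hLC (x : L).2)) _ z.2.2)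
        have h1 : l ^ Nat.card X = (z : L) ^ Nat.card X := by
          rw [← hzx, hcomm.mul_pow, ← Subgroup.coe_pow X, pow_card_eq_one', Subgroup.coe_one,
            mul_one]
        have hZ' : IsPGroup p ((C ⊓ N).subgroupOf L) := hZp.comap_subtype
        have h2 : z ^ Nat.card X = 1 := by
          refine hZ'.eq_one_of_coprime (hl.coprime_dvd_right ?_)
          rw [← Subgroup.orderOf_coe, Subgroup.coe_pow, ← h1]
          exact orderOf_pow_dvd _
        have h3 : z = 1 := hZ'.eq_one_of_coprime
          (hXcard.coprime_dvd_right (orderOf_dvd_of_pow_eq_one h2))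
        rw [← hzx, h3, Subgroup.coe_one, one_mul]
        exact x.2
    have hXn : (X.map L.subtype).Normal := by
      refine ⟨?_⟩
      rintro _ ⟨l, hl, rfl⟩ g
      refine ⟨⟨g * l * g⁻¹, hLn.conj_mem _ l.2 g⟩, (hmem _).2 ?_, rfl⟩
      have h1 := (hmem l).1 hl
      have h2 : orderOf (g * (l : G) * g⁻¹) = orderOf (l : G) :=
        orderOf_injective (MulAut.conj g).toMonoidHom (MulAut.conj g).injective (l : G)
      change p.Coprime (orderOf (g * (l : G) * g⁻¹))
      rwa [h2]
    have hX1 := hO _ hXn (by rwa [Subgroup.card_map_of_injective L.subtype_injective])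
    have hX2 : X = ⊥ := (Subgroup.map_eq_bot_iff_of_injective X L.subtype_injective).1 hX1
    rw [hX2, Subgroup.isComplement'_bot_right] at hX
    exact hL.lt.not_ge (Subgroup.subgroupOf_eq_top.1 hX)

/-- Sylow's theorem in `PN`, with a conjugating element chosen in `N`. -/
theorem Sylow.exists_smul_ge {N Q : Subgroup G} [N.Normal] (P : Sylow p G) (hQ : IsPGroup p Q)
    (h : Q ≤ (P : Subgroup G) ⊔ N) : ∃ n ∈ N, Q ≤ ((n • P : Sylow p G) : Subgroup G) := by
  set M := (P : Subgroup G) ⊔ N with hM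
  have hPM : (P : Subgroup G) ≤ M := le_sup_left
  obtain ⟨S, hS⟩ := (hQ.comap_subtype (K := M)).exists_le_sylow
  obtain ⟨m, hm⟩ := MulAction.exists_smul_eq M (P.subtype hPM) S
  have hm2 : (m : G) ∈ N ⊔ (P : Subgroup G) := by rw [sup_comm]; exact m.2
  obtain ⟨n, hn, u, hu, hnu⟩ := Subgroup.mem_sup_of_normal_left.1 hm2
  refine ⟨n, hn, fun x hx => ?_⟩
  have h1 : (⟨x, h hx⟩ : M) ∈ S := hS hx
  rw [← hm, Sylow.smul_subtype] at h1
  have h2 : x ∈ ((m : G) • P : Sylow p G) := h1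
  rw [← hnu, mul_smul, Sylow.smul_eq_iff_mem_normalizer.2 (Subgroup.le_normalizer hu)] at h2
  exact h2

end

/-! ### Subgroups containing the Sylow subgroup and quotients by normal `p'`-subgroups -/

section

variable {G : Type*} [Group G] {p : ℕ}

/-- The embedding condition on the subgroups of order `p` (and, if `p = 2`, of order `4`) of the
intersection of `P`, `P ^ x` and the `p`-supersolvable residual. -/
def EmbeddingCondition (P : Sylow p G) (x : G) : Prop :=
  (∀ H : Subgroup G, H ≤ residualInter P x → Nat.card H = p → IsCEmbedded H (P : Subgroup G)) ∧
    (p = 2 → ¬ IsQuaternionFree (residualInter P x) →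
      ∀ H : Subgroup G, H ≤ residualInter P x → IsCyclic H → Nat.card H = 4 →
        IsCEmbedded H (P : Subgroup G))

theorem Subgroup.mem_map_center {K : Subgroup G} {y : G} :
    y ∈ (Subgroup.center K).map K.subtype ↔ y ∈ K ∧ ∀ k ∈ K, k * y = y * k := by
  constructor
  · rintro ⟨c, hc, rfl⟩
    exact ⟨c.2, fun k hk => congrArg Subtype.val (Subgroup.mem_center_iff.1 hc ⟨k, hk⟩)⟩
  · rintro ⟨hy, h⟩
    exact ⟨⟨y, hy⟩, Subgroup.mem_center_iff.2 fun k => Subtype.ext (h k k.2), rfl⟩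

theorem mul_eq_univ_iff {H B : Subgroup G} :
    (H : Set G) * (B : Set G) = Set.univ ↔ ∀ g, ∃ h ∈ H, ∃ b ∈ B, h * b = g := by
  simp only [Set.eq_univ_iff_forall, Set.mem_mul, SetLike.mem_coe]

/-- Modulo `R`, the element `y` lies both in a `p`-subgroup and in a `p'`-subgroup. -/
theorem mem_of_mem_sup {R N H : Subgroup G} [R.Normal] [N.Normal] (hH : IsPGroup p H)
    (hN : p.Coprime (Nat.card N)) {y : G} (hy : y ∈ H) (hyRN : y ∈ R ⊔ N) : y ∈ R := by
  obtain ⟨r, hr, n, hn, rfl⟩ := Subgroup.mem_sup_of_normal_right.1 hyRN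
  have h1 : QuotientGroup.mk' R (r * n) = QuotientGroup.mk' R n := by
    rw [map_mul, show QuotientGroup.mk' R r = 1 from (QuotientGroup.eq_one_iff r).2 hr, one_mul]
  have h2 : p.Coprime (orderOf (QuotientGroup.mk' R (r * n))) := by
    rw [h1]
    refine hN.coprime_dvd_right ((orderOf_map_dvd _ n).trans ?_)
    have := orderOf_dvd_natCard (⟨n, hn⟩ : N)
    rwa [← Subgroup.orderOf_coe] at this
  have h3 := (hH.map (QuotientGroup.mk' R)).eq_one_of_coprime
    (g := ⟨_, Subgroup.mem_map_of_mem (QuotientGroup.mk' R) hy⟩)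
    (by rwa [← Subgroup.orderOf_coe])
  exact (QuotientGroup.eq_one_iff _).1 (congrArg Subtype.val h3)

theorem eq_of_map_eq_of_coprime_ker {G' : Type*} [Group G'] {f : G →* G'}
    (hker : p.Coprime (Nat.card f.ker)) {Q : Subgroup G} (hQ : IsPGroup p Q) {a b : G} (ha : a ∈ Q)
    (hb : b ∈ Q) (hab : f a = f b) : a = b := by
  have hmem : a * b⁻¹ ∈ f.ker := by
    rw [MonoidHom.mem_ker, map_mul, map_inv, hab, mul_inv_cancel]
  have h := hQ.eq_one_of_coprime (g := ⟨a * b⁻¹, mul_mem ha (inv_mem hb)⟩) (by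
    refine hker.coprime_dvd_right ?_
    have := orderOf_dvd_natCard (⟨a * b⁻¹, hmem⟩ : f.ker)
    rw [← Subgroup.orderOf_coe] at this ⊢
    exact this)
  exact mul_inv_eq_one.1 (congrArg Subtype.val h)

variable [Finite G] [hp : Fact p.Prime]

theorem EmbeddingCondition.subtype {P : Sylow p G} {M : Subgroup G} (hPM : (P : Subgroup G) ≤ M)
    {x : M} (h : EmbeddingCondition P (x : G)) : EmbeddingCondition (P.subtype hPM) x := by
  have hle : (residualInter (P.subtype hPM) x).map M.subtype ≤ residualInter P (x : G) := by
    rintro _ ⟨y, ⟨⟨hy1, hy2⟩, hy3⟩, rfl⟩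
    refine ⟨⟨map_residual_subtype_le M ⟨y, hy1, rfl⟩, hy2⟩, ?_⟩
    rw [SetLike.mem_coe, Sylow.smul_subtype] at hy3
    exact hy3
  have hemb : ∀ H : Subgroup M, IsCEmbedded (H.map M.subtype) (P : Subgroup G) →
      IsCEmbedded H (P.subtype hPM : Subgroup M) := by
    rintro H ⟨hHP, B, hB, hHB⟩
    refine ⟨fun y hy => hHP ⟨y, hy, rfl⟩, B.subgroupOf M, ?_, ?_⟩
    · rw [mul_eq_univ_iff] at hB ⊢
      intro g
      obtain ⟨_, ⟨k, hk, rfl⟩, b, hb, hkb⟩ := hB g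
      have hbk : b = ((k⁻¹ * g : M) : G) := by
        change b = (k : G)⁻¹ * g
        rw [← hkb]
        exact (inv_mul_cancel_left (k : G) b).symm
      refine ⟨k, hk, k⁻¹ * g, ?_, mul_inv_cancel_left k g⟩
      rw [Subgroup.mem_subgroupOf, ← hbk]
      exact hb
    · rintro y ⟨hyH, hyB⟩
      have := Subgroup.mem_map_center.1 (hHB ⟨⟨y, hyH, rfl⟩, hyB⟩)
      exact Subgroup.mem_map_center.2 ⟨this.1, fun k hk => Subtype.ext (this.2 k hk)⟩
  refine ⟨fun H hH hcard => hemb H (h.1 _ ((Subgroup.map_mono hH).trans hle) ?_),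
    fun hp2 hQ H hH hcyc hcard => hemb H (h.2 hp2 (fun hQ' => hQ ?_) _
      ((Subgroup.map_mono hH).trans hle) ?_ ?_)⟩
  · rw [Subgroup.card_map_of_injective M.subtype_injective, hcard]
  · let f : residualInter (P.subtype hPM) x →* residualInter P (x : G) :=
      (M.subtype.comp (residualInter (P.subtype hPM) x).subtype).codRestrict _
        fun y => hle ⟨y, y.2, rfl⟩
    exact hQ'.of_injective f fun a b hab =>
      Subtype.ext (Subtype.ext (congrArg (Subtype.val : residualInter P (x : G) → G) hab))
  · exact (H.equivMapOfInjective M.subtype M.subtype_injective).isCyclic.1 hcyc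
  · rw [Subgroup.card_map_of_injective M.subtype_injective, hcard]

/-- If `G = HB` with `H` a `p`-group, then `B` contains every normal `p'`-subgroup. -/
theorem le_of_mul_eq_univ {H B N : Subgroup G} [N.Normal] (hH : IsPGroup p H)
    (hHB : (H : Set G) * (B : Set G) = Set.univ) (hN : p.Coprime (Nat.card N)) : N ≤ B := by
  rw [mul_eq_univ_iff] at hHB
  have hidx : ∃ k, B.index = p ^ k := by
    obtain ⟨k, hk⟩ := hH.card_orbit ((1 : G) : G ⧸ B)
    refine ⟨k, ?_⟩
    rw [← hk]
    have : MulAction.orbit H ((1 : G) : G ⧸ B) = Set.univ := by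
      refine Set.eq_univ_of_forall fun x => ?_
      obtain ⟨g, rfl⟩ := QuotientGroup.mk_surjective x
      obtain ⟨a, ha, b, hb, rfl⟩ := hHB g
      refine ⟨⟨a, ha⟩, QuotientGroup.eq.2 ?_⟩
      change (a * 1)⁻¹ * (a * b) ∈ B
      rw [mul_one, inv_mul_cancel_left]
      exact hb
    rw [this, Nat.card_congr (Equiv.Set.univ _)]
    rfl
  obtain ⟨k, hk⟩ := hidx
  rw [← Subgroup.relIndex_eq_one]
  have h1 : Nat.card N * N.relIndex B = Nat.card B * B.relIndex N := by
    have e1 : Nat.card (B ⊓ N : Subgroup G) * B.relIndex N = Nat.card N := by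
      rw [← Subgroup.inf_relIndex_right, ← Subgroup.relIndex_bot_left,
        Subgroup.relIndex_mul_relIndex _ _ _ bot_le inf_le_right, Subgroup.relIndex_bot_left]
    have e2 : Nat.card (B ⊓ N : Subgroup G) * N.relIndex B = Nat.card B := by
      rw [← Subgroup.inf_relIndex_left, ← Subgroup.relIndex_bot_left,
        Subgroup.relIndex_mul_relIndex _ _ _ bot_le inf_le_left, Subgroup.relIndex_bot_left]
    rw [← e1, ← e2]
    ring
  have h2 : B.relIndex N ∣ B.index := by
    have e1 := B.card_mul_index
    have e2 := N.card_mul_index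
    obtain ⟨t, ht⟩ : N.relIndex B ∣ N.index := Subgroup.relIndex_dvd_index_of_normal N B
    refine ⟨t, Nat.eq_of_mul_eq_mul_left (Nat.card_pos (α := B)) ?_⟩
    rw [e1, ← e2, ht, ← mul_assoc, ← mul_assoc, h1]
  rw [hk] at h2
  exact Nat.Coprime.eq_one_of_dvd
    ((hN.pow_left k).coprime_dvd_left h2) (Subgroup.relIndex_dvd_card B N)

/-- A surjection maps the normalizer of a Sylow subgroup onto that of its image. -/
theorem exists_mem_normalizer_of_mem_normalizer_map {G' : Type*} [Group G'] {f : G →* G'}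
    (hf : Function.Surjective f) (P : Sylow p G) {g' : G'}
    (hg' : g' ∈ Subgroup.normalizer (P.mapSurjective hf : Set G')) :
    ∃ g ∈ Subgroup.normalizer (P : Set G), f g = g' := by
  obtain ⟨g, rfl⟩ := hf g'
  have hle : ((g • P : Sylow p G) : Subgroup G) ≤ (P : Subgroup G) ⊔ f.ker := by
    rw [← Subgroup.comap_map_eq]
    rintro _ ⟨u, hu, rfl⟩
    have h1 := (Subgroup.mem_normalizer_iff.1 hg' (f u)).1 ⟨u, hu, rfl⟩
    rw [← map_inv, ← map_mul, ← map_mul] at h1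
    exact h1
  obtain ⟨n, hn, h⟩ := P.exists_smul_ge (g • P).2 hle
  have heq : g • P = n • P := Sylow.ext ((g • P).3 (n • P).2 h).symm
  refine ⟨n⁻¹ * g, Sylow.smul_eq_iff_mem_normalizer.1 ?_, ?_⟩
  · rw [mul_smul, heq, inv_smul_smul]
  · rw [map_mul, map_inv, MonoidHom.mem_ker.1 hn, inv_one, one_mul]

/-- The intersection in the quotient lifts isomorphically into one single intersection upstairs:
a Sylow argument moves the lift into a conjugate of `P` by an element of the coset. -/
theorem EmbeddingCondition.mapSurjective {G' : Type*} [Group G'] [Finite G'] {f : G →* G'}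
    (hf : Function.Surjective f) (hker : p.Coprime (Nat.card f.ker)) {P : Sylow p G}
    (h : ∀ x : G, x ∉ Subgroup.normalizer (P : Set G) → EmbeddingCondition P x) {x' : G'}
    (hx' : x' ∉ Subgroup.normalizer (P.mapSurjective hf : Set G')) :
    EmbeddingCondition (P.mapSurjective hf) x' := by
  set I' := residualInter (P.mapSurjective hf) x' with hI'
  obtain ⟨x, rfl⟩ := hf x'
  let Q : Subgroup G := (P : Subgroup G) ⊓ I'.comap f
  have hQP : Q ≤ P := inf_le_left
  have hQp : IsPGroup p Q := P.2.to_le hQP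
  have hI'P : ∀ y ∈ I', ∃ q ∈ Q, f q = y := by
    intro y hy
    obtain ⟨q, hq, rfl⟩ := hy.1.2
    exact ⟨q, ⟨hq, hy⟩, rfl⟩
  have hQx : Q ≤ ((x⁻¹ • P : Sylow p G) : Subgroup G) ⊔ f.ker := by
    rw [← Subgroup.comap_map_eq]
    rintro q ⟨-, hq⟩
    obtain ⟨w, hw, hwq⟩ := hq.2
    obtain ⟨u, hu, rfl⟩ := hw
    refine ⟨x⁻¹ * u * x⁻¹⁻¹, ⟨u, hu, rfl⟩, ?_⟩
    have h1 : f (x⁻¹ * u * x⁻¹⁻¹) = (f x)⁻¹ * f u * (f x)⁻¹⁻¹ := by simp only [map_mul, map_inv]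
    rw [h1]
    exact hwq
  obtain ⟨n, hn, hQn⟩ := (x⁻¹ • P).exists_smul_ge hQp hQx
  have hfn : f (x * n⁻¹) = f x := by
    rw [map_mul, map_inv, MonoidHom.mem_ker.1 hn, inv_one, mul_one]
  have hxn : x * n⁻¹ ∉ Subgroup.normalizer (P : Set G) := by
    intro hcon
    refine hx' ?_
    rw [← hfn]
    exact Subgroup.le_normalizer_map f ⟨_, hcon, rfl⟩
  have hQI : Q ≤ residualInter P (x * n⁻¹) := by
    intro q hq
    refine ⟨⟨?_, hQP hq⟩, ?_⟩
    · refine mem_of_mem_sup hQp hker hq ?_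
      rw [← Subgroup.comap_map_eq]
      exact residual_le_map hf hq.2.1.1
    · rw [mul_inv_rev, inv_inv, mul_smul]
      exact hQn hq
  have hc := h _ hxn
  -- the lift of a subgroup of `I'`
  let lift : Subgroup G' → Subgroup G := fun H => Q ⊓ H.comap f
  have hlift_equiv : ∀ H ≤ I', Nonempty (lift H ≃* H) := by
    intro H hH
    let φ : lift H →* H := (f.comp (lift H).subtype).codRestrict H fun q => q.2.2
    refine ⟨MulEquiv.ofBijective φ ⟨fun a b hab => ?_, fun y => ?_⟩⟩
    · exact Subtype.ext (eq_of_map_eq_of_coprime_ker hker hQp a.2.1 b.2.1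
        (congrArg (Subtype.val : H → G') hab))
    · obtain ⟨q, hq, hqy⟩ := hI'P y (hH y.2)
      exact ⟨⟨q, hq, show f q ∈ H by rw [hqy]; exact y.2⟩, Subtype.ext hqy⟩
  have hemb : ∀ H ≤ I', IsCEmbedded (lift H) (P : Subgroup G) →
      IsCEmbedded H (P.mapSurjective hf : Subgroup G') := by
    rintro H hH ⟨-, B, hB, hHB⟩
    have hNB : f.ker ≤ B := le_of_mul_eq_univ (hQp.to_le inf_le_left) hB hker
    rw [mul_eq_univ_iff] at hB
    refine ⟨fun y hy => (hH hy).1.2, B.map f, ?_, ?_⟩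
    · rw [mul_eq_univ_iff]
      intro g'
      obtain ⟨g, rfl⟩ := hf g'
      obtain ⟨k, hk, b, hb, rfl⟩ := hB g
      exact ⟨f k, hk.2, f b, ⟨b, hb, rfl⟩, (map_mul f k b).symm⟩
    · rintro y ⟨hyH, b, hb, rfl⟩
      obtain ⟨q, hq, hqb⟩ := hI'P _ (hH hyH)
      have hqB : q ∈ B := by
        have h1 : q * b⁻¹ ∈ f.ker := by
          rw [MonoidHom.mem_ker, map_mul, map_inv, hqb, mul_inv_cancel]
        simpa using mul_mem (hNB h1) hb
      have hqc := Subgroup.mem_map_center.1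
        (hHB ⟨⟨hq, by change f q ∈ H; rw [hqb]; exact hyH⟩, hqB⟩)
      refine Subgroup.mem_map_center.2 ⟨(hH hyH).1.2, ?_⟩
      rintro _ ⟨k, hk, rfl⟩
      rw [← hqb, ← map_mul, ← map_mul, hqc.2 k hk]
  refine ⟨fun H hH hcard => hemb H hH (hc.1 _ (inf_le_left.trans hQI) ?_),
    fun hp2 hI'Q H hH hcyc hcard => hemb H hH (hc.2 hp2 (fun hQ' => hI'Q ?_) _
      (inf_le_left.trans hQI) ?_ ?_)⟩
  · obtain ⟨e⟩ := hlift_equiv H hH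
    rw [Nat.card_congr e.toEquiv, hcard]
  · obtain ⟨e⟩ := hlift_equiv I' le_rfl
    have hle : lift I' ≤ residualInter P (x * n⁻¹) := inf_le_left.trans hQI
    exact hQ'.of_injective ((Subgroup.inclusion hle).comp e.symm.toMonoidHom)
      ((Subgroup.inclusion_injective hle).comp e.symm.injective)
  · obtain ⟨e⟩ := hlift_equiv H hH
    exact e.isCyclic.2 hcyc
  · obtain ⟨e⟩ := hlift_equiv H hH
    rw [Nat.card_congr e.toEquiv, hcard]

end

/-! ### The minimal configuration -/

theorem IsPGroup.mem_sylow_of_mem_normalizer {G : Type*} [Group G] {p : ℕ} {P : Sylow p G} {Q : Subgroup G} (hQ : IsPGroup p Q)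
    {y : G} (hy : y ∈ Q) (hyP : y ∈ Subgroup.normalizer (P : Set G)) : y ∈ P := by
  have h : y ∈ Q ⊓ Subgroup.normalizer (P : Set G) := ⟨hy, hyP⟩
  rw [hQ.inf_normalizer_sylow P] at h
  exact h.2

theorem conj_mem_sylow {G : Type*} [Group G] {p : ℕ} {P : Sylow p G} {u : G} (hu : u ∈ P) (g : G)
    (h : g * u * g⁻¹ ∈ Subgroup.normalizer (P : Set G)) : g * u * g⁻¹ ∈ P :=
  (g • P).2.mem_sylow_of_mem_normalizer (y := g * u * g⁻¹) ⟨u, hu, rfl⟩ h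

section

universe u

variable {G : Type u} [Group G] [Finite G] {p : ℕ} [hp : Fact p.Prime]

/-- If `R` is a normal `p`-subgroup and `G = ⟨a⟩ B` with `a ∈ R ∖ B` and `a ^ p ∈ B`, then `B ∩ R`
is normal in `G` of index `p` in `R`. -/
theorem exists_normal_relIndex_eq_prime {R B : Subgroup G} [hRn : R.Normal] (hR : IsPGroup p R)
    {a : G} (haR : a ∈ R) (haB : a ∉ B) (hap : a ^ p ∈ B)
    (hB : (Subgroup.zpowers a : Set G) * (B : Set G) = Set.univ) :
    ∃ T : Subgroup G, T.Normal ∧ T ≤ R ∧ T.relIndex R = p := by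
  rw [mul_eq_univ_iff] at hB
  have hidx : (B.subgroupOf R).index = p := by
    obtain ⟨k, hk⟩ := hR.index (B.subgroupOf R)
    have hk0 : k ≠ 0 := by
      rintro rfl
      rw [pow_zero] at hk
      exact haB (Subgroup.relIndex_eq_one.1 hk haR)
    have hle : (B.subgroupOf R).index ≤ p := by
      have hsurj : Function.Surjective fun i : Fin p =>
          (QuotientGroup.mk (⟨a, haR⟩ ^ (i : ℕ)) : R ⧸ B.subgroupOf R) := by
        intro x
        obtain ⟨r, rfl⟩ := QuotientGroup.mk_surjective x
        obtain ⟨c, hc, b, hb, hcb⟩ := hB r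
        obtain ⟨m, rfl⟩ := Subgroup.mem_zpowers_iff.1 hc
        have hp0 : (p : ℤ) ≠ 0 := by exact_mod_cast hp.out.ne_zero
        have hmod0 := Int.emod_nonneg m hp0
        have hmodlt := Int.emod_lt_of_pos m (by exact_mod_cast hp.out.pos : (0 : ℤ) < p)
        refine ⟨⟨(m % p).toNat, by omega⟩, QuotientGroup.eq.2 ?_⟩
        rw [Subgroup.mem_subgroupOf]
        change (a ^ (m % p).toNat)⁻¹ * (r : G) ∈ B
        have h1 : a ^ m = a ^ (m % p).toNat * (a ^ p) ^ (m / p) := by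
          rw [← zpow_natCast, ← zpow_natCast a p, ← zpow_mul, ← zpow_add, Int.toNat_of_nonneg hmod0,
            Int.emod_add_mul_ediv]
        rw [← hcb, h1, ← mul_assoc, ← mul_assoc, inv_mul_cancel, one_mul]
        exact mul_mem (zpow_mem hap _) hb
      have := Nat.card_le_card_of_surjective _ hsurj
      rwa [Nat.card_fin] at this
    rw [hk] at hle ⊢
    have : k ≤ 1 := (Nat.pow_le_pow_iff_right hp.out.one_lt).1 (hle.trans (pow_one p).ge)
    rw [show k = 1 by omega, pow_one]
  have hn := hR.normal_of_index_eq_prime hidx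
  refine ⟨B ⊓ R, ⟨fun t ht g => ⟨?_, hRn.conj_mem t ht.2 g⟩⟩, inf_le_right, ?_⟩
  · obtain ⟨c, hc, b, hb, rfl⟩ := hB g
    have hcR : c ∈ R := (Subgroup.zpowers_le.2 haR) hc
    have h1 : b * t * b⁻¹ ∈ B := mul_mem (mul_mem hb ht.1) (inv_mem hb)
    have h2 := hn.conj_mem ⟨b * t * b⁻¹, hRn.conj_mem t ht.2 b⟩ h1 ⟨c, hcR⟩
    have h3 : c * (b * t * b⁻¹) * c⁻¹ ∈ B := h2
    have h4 : c * b * t * (c * b)⁻¹ = c * (b * t * b⁻¹) * c⁻¹ := by group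
    exact h4 ▸ h3
  · rw [Subgroup.inf_relIndex_right]
    exact hidx

/-- A subgroup that contains a Sylow `p`-subgroup and all elements of order prime to `p` is the
whole group. -/
theorem eq_top_of_sylow_le {P : Sylow p G} {L : Subgroup G} (hP : (P : Subgroup G) ≤ L)
    (h : ∀ g : G, p.Coprime (orderOf g) → g ∈ L) : L = ⊤ := by
  rw [← Subgroup.index_eq_one, Nat.eq_one_iff_not_exists_prime_dvd]
  intro q hq hdvd
  have := Fact.mk hq
  by_cases hqp : q = p
  · subst hqp
    exact P.not_dvd_index (hdvd.trans (Subgroup.index_dvd_of_le hP))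
  · obtain ⟨Q⟩ : Nonempty (Sylow q G) := inferInstance
    refine Q.not_dvd_index (hdvd.trans (Subgroup.index_dvd_of_le fun g hg => h g ?_))
    have := Q.2.orderOf_coprime (n := p) ((Nat.coprime_primes hq hp.out).2 hqp) ⟨g, hg⟩
    rw [← Subgroup.orderOf_coe] at this
    exact this.symm

/-- If every proper subgroup above `P` normalizes `P`, the quotient of `G` by its largest normal
`p`-subgroup has a normal `p`-complement, so it is `p`-supersolvable. -/
theorem residual_le_normalCore (hG : IsPSolvable p G) {P : Sylow p G}
    (hov : ∀ M : Subgroup G, (P : Subgroup G) ≤ M → M ≠ ⊤ → M ≤ Subgroup.normalizer (P : Set G)) :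
    pSupersolvableResidual p G ≤ (P : Subgroup G).normalCore := by
  set N := (P : Subgroup G).normalCore with hN
  obtain ⟨L, ⟨hLn, hNL, hcop⟩, hmax⟩ := (Set.toFinite
    {L : Subgroup G | L.Normal ∧ N ≤ L ∧ p.Coprime (N.relIndex L)}).exists_maximal
    ⟨N, inferInstance, le_rfl, by rw [Subgroup.relIndex_self]; exact Nat.coprime_one_right p⟩
  by_cases htop : L ⊔ (P : Subgroup G) = ⊤
  · refine pSupersolvableResidual_le (.step inferInstance hNL (.inr hcop)
      (hasNormalSeries_of_isChiefFactor L fun H K hHK hLH => ?_))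
    rcases hG H K hHK with ⟨n, hn⟩ | h
    · refine .inl (hHK.relIndex_eq_prime hn P.2 fun M hPM hM => ?_).dvd
      rw [← top_le_iff, ← htop]
      have := hHK.normal_bot
      refine sup_le (fun l hl => hM l fun a _ => ?_) hPM
      have h1 := mul_mem (hLH hl) (this.conj_mem l⁻¹ (inv_mem (hLH hl)) a)
      have h2 : ⁅l, a⁆ = l * (a * l⁻¹ * a⁻¹) := by rw [commutatorElement_def]; group
      exact h2 ▸ h1
    · exact .inr h
  · exfalso
    have hLtop : L ≠ ⊤ := fun h => htop (by rw [h, top_sup_eq])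
    obtain ⟨K, hK, -⟩ := exists_isChiefFactor (lt_top_iff_ne_top.2 hLtop)
    have hKn := hK.normal_top
    rcases hG L K hK with ⟨n, hn⟩ | h
    · have hKP : K ≤ L ⊔ (P : Subgroup G) := by
        have hmap : (K.map (QuotientGroup.mk' L)).Normal :=
          hKn.map _ (QuotientGroup.mk'_surjective L)
        have hKp : IsPGroup p (K.map (QuotientGroup.mk' L)) := by
          refine IsPGroup.of_card (n := n) ?_
          rw [← hn, ← Subgroup.relIndex_ker, QuotientGroup.ker_mk']
        have h1 := hKp.le_sylow_of_normal (P.mapSurjective (QuotientGroup.mk'_surjective L))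
        rw [Sylow.coe_mapSurjective, Subgroup.map_le_iff_le_comap, Subgroup.comap_map_eq,
          QuotientGroup.ker_mk', sup_comm] at h1
        exact h1
      have hKN : K ≤ Subgroup.normalizer (P : Set G) := hKP.trans (hov _ le_sup_right htop)
      -- `K ∩ P` is a normal `p`-subgroup of `G` that supplements `L` in `K`
      have hS : (K ⊓ (P : Subgroup G)).Normal := ⟨fun s hs g =>
        have h1 := hKn.conj_mem s hs.1 g
        ⟨h1, conj_mem_sylow hs.2 g (hKN h1)⟩⟩
      have hSN : K ⊓ (P : Subgroup G) ≤ L :=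
        (Subgroup.normal_le_normalCore.2 inf_le_right).trans hNL
      refine hK.lt.not_ge fun x hx => ?_
      obtain ⟨l, hl, u, hu, rfl⟩ := Subgroup.mem_sup_of_normal_left.1 (hKP hx)
      exact mul_mem hl (hSN ⟨(Subgroup.mul_mem_cancel_left K (hK.lt.le hl)).1 hx, hu⟩)
    · refine hK.lt.not_ge (hmax ⟨hKn, hNL.trans hK.lt.le, ?_⟩ hK.lt.le)
      rw [← Subgroup.relIndex_mul_relIndex N L K hNL hK.lt.le]
      exact hcop.mul_right h

/-- The residual is a normal `p`-subgroup, and embedded cyclic subgroups of it are central unless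
they yield a chief factor of order `p` at its top. Once they are central, all `p'`-elements
centralize the residual, which again yields such a factor unless the residual is trivial. -/
theorem isPSupersolvable_of_forall_le_normalizer (hG : IsPSolvable p G) {P : Sylow p G}
    (hPn : ¬ (P : Subgroup G).Normal)
    (hov : ∀ M : Subgroup G, (P : Subgroup G) ≤ M → M ≠ ⊤ → M ≤ Subgroup.normalizer (P : Set G))
    (hemb : ∀ x : G, x ∉ Subgroup.normalizer (P : Set G) → EmbeddingCondition P x) :
    IsPSupersolvable p G := by
  refine isPSupersolvable_of_residual_eq_bot ?_
  by_contra hRbot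
  have hRN := residual_le_normalCore hG hov
  set R := pSupersolvableResidual p G with hRdef
  have hRn : R.Normal := pSupersolvableResidual_normal
  have hRP : R ≤ P := hRN.trans (Subgroup.normalCore_le _)
  have hR : IsPGroup p R := P.2.to_le hRP
  obtain ⟨x, hx⟩ : ∃ x, x ∉ Subgroup.normalizer (P : Set G) := by
    by_contra hcon
    push Not at hcon
    exact hPn (Subgroup.normalizer_eq_top_iff.1 (top_le_iff.1 fun g _ => hcon g))
  have hRx : residualInter P x = R :=
    le_antisymm (inf_le_left.trans inf_le_left)
      (le_inf (le_inf le_rfl hRP) (hR.le_sylow_of_normal _))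
  have hc := hemb x hx
  rw [EmbeddingCondition, hRx] at hc
  -- no chief factor of order `p` lies directly below the residual
  have hno : ∀ T : Subgroup G, T.Normal → T ≤ R → T.relIndex R ≠ p := by
    intro T hT hTR hidx
    have h1 : R ≤ T := pSupersolvableResidual_le
      (.step hT hTR (.inl hidx.dvd) (hasNormalSeries_residual G p))
    rw [Subgroup.relIndex_eq_one.2 h1] at hidx
    exact hp.out.one_lt.ne hidx
  -- the normal closure of `P` is `G`, so what is centralized by `P` is central
  have hnormal : ∀ L : Subgroup G, L.Normal → (P : Subgroup G) ≤ L → L = ⊤ := by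
    intro L hL hPL
    by_contra hLtop
    exact hPn ⟨fun u hu g => conj_mem_sylow hu g (hov L hPL hLtop (hL.conj_mem u (hPL hu) g))⟩
  have hcentral : ∀ A : Set G, (∀ a ∈ A, ∀ g, g * a * g⁻¹ ∈ A) →
      (∀ a ∈ A, ∀ u ∈ (P : Subgroup G), u * a = a * u) → ∀ a ∈ A, ∀ g, Commute g a := by
    intro A hA hPA a ha g
    have hL : (Subgroup.centralizer A).Normal := by
      refine ⟨fun c hc g => Subgroup.mem_centralizer_iff.2 fun b hb => ?_⟩
      have h1 := Subgroup.mem_centralizer_iff.1 hc _ (hA b hb g⁻¹)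
      rw [inv_inv] at h1
      calc b * (g * c * g⁻¹) = g * (g⁻¹ * b * g * c) * g⁻¹ := by group
        _ = g * c * g⁻¹ * b := by rw [h1]; group
    have hg : g ∈ Subgroup.centralizer A := by
      rw [hnormal _ hL fun u hu => Subgroup.mem_centralizer_iff.2 fun b hb => (hPA b hb u hu).symm]
      exact Subgroup.mem_top g
    exact (Subgroup.mem_centralizer_iff.1 hg a ha).symm
  have hpcen : ∀ a ∈ R, a ^ p = 1 → ∀ g, Commute g a := by
    have := hcentral {a | a ∈ R ∧ a ^ p = 1}
      (fun a ha g => ⟨hRn.conj_mem a ha.1 g, by rw [conj_pow, ha.2, mul_one, mul_inv_cancel]⟩) ?_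
    · exact fun a ha hap => this a ⟨ha, hap⟩
    rintro a ⟨haR, hap⟩
    by_cases ha1 : a = 1
    · intro u _
      rw [ha1, mul_one, one_mul]
    obtain ⟨-, B, hB, haB⟩ := hc.1 (Subgroup.zpowers a) (Subgroup.zpowers_le.2 haR)
      (by rw [Nat.card_zpowers, orderOf_eq_prime hap ha1])
    by_cases haB' : a ∈ B
    · exact (Subgroup.mem_map_center.1 (haB ⟨Subgroup.mem_zpowers a, haB'⟩)).2
    · obtain ⟨T, hT, hTR, hidx⟩ := exists_normal_relIndex_eq_prime hR haR haB'
        (by rw [hap]; exact one_mem B) hB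
      exact absurd hidx (hno T hT hTR)
  have h4cen : p = 2 → ¬ IsQuaternionFree R → ∀ a ∈ R, a ^ 4 = 1 → ∀ g, Commute g a := by
    intro hp2 hQ
    have := hcentral {a | a ∈ R ∧ a ^ 4 = 1}
      (fun a ha g => ⟨hRn.conj_mem a ha.1 g, by rw [conj_pow, ha.2, mul_one, mul_inv_cancel]⟩) ?_
    · exact fun a ha hap => this a ⟨ha, hap⟩
    rintro a ⟨haR, ha4⟩
    by_cases ha2 : a ^ 2 = 1
    · exact fun u _ => hpcen a haR (by rw [hp2, ha2]) u
    have hord : orderOf a = 4 := orderOf_eq_prime_pow (p := 2) (n := 1) (by rwa [pow_one]) ha4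
    obtain ⟨-, B, hB, haB⟩ := hc.2 hp2 hQ (Subgroup.zpowers a) (Subgroup.zpowers_le.2 haR)
      inferInstance (by rw [Nat.card_zpowers, hord])
    by_cases haB' : a ∈ B
    · exact (Subgroup.mem_map_center.1 (haB ⟨Subgroup.mem_zpowers a, haB'⟩)).2
    · -- as `a ^ 2` is central, `B` may be replaced by `B ⟨a ^ 2⟩`
      have ha2cen : ∀ g, Commute g (a ^ 2) := hpcen (a ^ 2) (pow_mem haR 2)
        (by rw [hp2, ← pow_mul]; exact ha4)
      have hzn : (Subgroup.zpowers (a ^ 2)).Normal := ⟨fun y hy g => by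
        obtain ⟨k, rfl⟩ := Subgroup.mem_zpowers_iff.1 hy
        rwa [((ha2cen g).zpow_right k).eq, mul_inv_cancel_right]⟩
      have haB2 : a ∉ B ⊔ Subgroup.zpowers (a ^ 2) := by
        intro hcon
        obtain ⟨b, hb, c, hc', hbc⟩ := Subgroup.mem_sup_of_normal_right.1 hcon
        obtain ⟨k, rfl⟩ := Subgroup.mem_zpowers_iff.1 hc'
        have hbk : b = a ^ (1 - 2 * k) := by
          rw [zpow_sub, zpow_one, zpow_mul, zpow_ofNat]
          exact eq_mul_inv_of_mul_eq hbc
        have h1 : (a ^ (1 - 2 * k)) ^ (1 - 2 * k) = a := by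
          rw [← zpow_mul, show (1 - 2 * k) * (1 - 2 * k) = 1 + 4 * (k * k - k) by ring, zpow_add,
            zpow_one, zpow_mul, zpow_ofNat, ha4, one_zpow, mul_one]
        exact haB' (h1 ▸ zpow_mem (hbk ▸ hb) _)
      obtain ⟨T, hT, hTR, hidx⟩ := exists_normal_relIndex_eq_prime hR haR haB2
        (by rw [hp2]; exact Subgroup.mem_sup_right (Subgroup.mem_zpowers _))
        (Set.eq_univ_of_univ_subset (hB ▸ Set.mul_subset_mul_left
          (SetLike.coe_subset_coe.2 le_sup_left)))
      exact absurd hidx (hno T hT hTR)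
  have hp' : ∀ g : G, p.Coprime (orderOf g) → ∀ r ∈ R, Commute g r := by
    intro g hg r hr
    have hfix := hR.fixed_of_fixed_of_pow_eq_one hg (α := (MulAut.conjNormal g).toMonoidHom)
      (fun y => ?_) (fun y hy => ?_) (fun hp2 => ?_) ⟨r, hr⟩
    · exact mul_inv_eq_iff_eq_mul.1 (congrArg Subtype.val hfix)
    · rw [iterate_conjNormal, pow_orderOf_eq_one, map_one]; rfl
    · exact Subtype.ext (mul_inv_eq_iff_eq_mul.2
        (hpcen y y.2 (by rw [← R.coe_pow, hy, R.coe_one]) g).eq)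
    · by_cases hQ : IsQuaternionFree R
      · exact .inr hQ
      · exact .inl fun y hy => Subtype.ext (mul_inv_eq_iff_eq_mul.2
          (h4cen hp2 hQ y y.2 (by rw [← R.coe_pow, hy, R.coe_one]) g).eq)
  obtain ⟨K, hK, -⟩ := exists_isChiefFactor_top (bot_lt_iff_ne_bot.2 hRbot)
  obtain ⟨n, hn⟩ := hR.index (K.subgroupOf R)
  refine hno K hK.normal_bot hK.lt.le (hK.relIndex_eq_prime hn P.2 fun L hPL hL => ?_)
  refine eq_top_of_sylow_le hPL fun g hg => hL g fun a ha => ?_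
  rw [commutatorElement_eq_one_iff_mul_comm.2 (hp' g hg a ha).eq]
  exact one_mem K

/-- Induction on the order of `G`: a nontrivial normal `p'`-subgroup can be factored out, and without one
every proper subgroup above `P` is `p`-supersolvable and therefore normalizes `P`. -/
theorem isPSupersolvable_of_embeddingCondition : ∀ (n : ℕ) (G : Type u) [Group G] [Finite G],
    Nat.card G = n → IsPSolvable p G → ∀ P : Sylow p G,
    IsPSupersolvable p (Subgroup.normalizer (P : Set G)) →
    (∀ x : G, x ∉ Subgroup.normalizer (P : Set G) → EmbeddingCondition P x) →
    IsPSupersolvable p G := by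
  intro n
  induction n using Nat.strong_induction_on with
  | _ n ih =>
    intro G _ _ hn hG P hPN hemb
    by_cases hPn : (P : Subgroup G).Normal
    · have htop : Subgroup.normalizer (P : Set G) = ⊤ := Subgroup.normalizer_eq_top_iff.2 hPn
      exact hPN.of_injective ((MonoidHom.id G).codRestrict _ fun g => htop ▸ Subgroup.mem_top g)
        fun a b hab => congrArg Subtype.val hab
    by_cases hO : ∀ X : Subgroup G, X.Normal → p.Coprime (Nat.card X) → X = ⊥
    · refine isPSupersolvable_of_forall_le_normalizer hG hPn (fun M hPM hMtop => ?_) hemb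
      have hM : IsPSupersolvable p M := by
        refine ih (Nat.card M) ?_ M rfl (hG.of_injective M.subtype M.subtype_injective)
          (P.subtype hPM) ?_ fun x hx => (hemb x fun hcon => hx ?_).subtype hPM
        · rw [← hn]
          exact lt_of_le_of_ne (Subgroup.card_le_card_group M)
            fun h => hMtop (Subgroup.eq_top_of_card_eq M h)
        · have hmem : ∀ y : Subgroup.normalizer (P.subtype hPM : Set M),
              ((y : M) : G) ∈ Subgroup.normalizer (P : Set G) := fun y => by
            have h1 := Sylow.smul_eq_iff_mem_normalizer.2 y.2
            rw [Sylow.smul_subtype] at h1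
            exact Sylow.smul_eq_iff_mem_normalizer.1 (Sylow.subtype_injective h1)
          exact hPN.of_injective ((M.subtype.comp (Subgroup.subtype _)).codRestrict _ hmem)
            fun a b hab => Subtype.ext (Subtype.ext
              (congrArg (Subtype.val : Subgroup.normalizer (P : Set G) → G) hab))
        · rw [← Sylow.smul_eq_iff_mem_normalizer] at hcon ⊢
          rw [Sylow.smul_subtype]
          exact Sylow.ext (by simp only [Sylow.coe_subtype]; rw [show x • P = P from hcon])
      have hNP : (P : Subgroup G).normalCore ≤ P := Subgroup.normalCore_le _
      have hNM : (P : Subgroup G).normalCore ≤ M := hNP.trans hPM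
      have hcen := hG.centralizer_le hO (P.2.to_le hNP) fun X hX hXp =>
        Subgroup.normal_le_normalCore.2 (hXp.le_sylow_of_normal P)
      have hPMn : (P.subtype hPM : Subgroup M).Normal := by
        refine hM.sylow_normal (N := (P : Subgroup G).normalCore.subgroupOf M)
          (P.2.to_le hNP).comap_subtype (fun y hy => ?_) _
        refine hcen (Subgroup.mem_centralizer_iff.2 fun z hz => ?_)
        exact congrArg Subtype.val (Subgroup.mem_centralizer_iff.1 hy ⟨z, hNM hz⟩ hz)
      rw [Sylow.coe_subtype] at hPMn
      exact (Subgroup.normal_subgroupOf_iff_le_normalizer hPM).1 hPMn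
    · push Not at hO
      obtain ⟨X, hX, hcop, hXbot⟩ := hO
      let q := QuotientGroup.mk' X
      have hq : Function.Surjective q := QuotientGroup.mk'_surjective X
      have hker : p.Coprime (Nat.card q.ker) := by rwa [QuotientGroup.ker_mk']
      have hquot : IsPSupersolvable p (G ⧸ X) := by
        refine ih (Nat.card (G ⧸ X)) ?_ (G ⧸ X) rfl (hG.of_surjective q hq) (P.mapSurjective hq) ?_
          fun x' hx' => EmbeddingCondition.mapSurjective hq hker hemb hx'
        · rw [← hn, ← X.card_mul_index]
          exact lt_mul_of_one_lt_left (Nat.card_pos (α := G ⧸ X))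
            (Subgroup.one_lt_card_iff_ne_bot X |>.2 hXbot)
        · have hmem : ∀ y : Subgroup.normalizer (P : Set G),
              q y ∈ Subgroup.normalizer (P.mapSurjective hq : Set (G ⧸ X)) := fun y =>
            Subgroup.le_normalizer_map q ⟨y, y.2, rfl⟩
          refine hPN.of_surjective ((q.comp (Subgroup.subtype _)).codRestrict _ hmem) ?_
          rintro ⟨y', hy'⟩
          obtain ⟨y, hy, rfl⟩ := exists_mem_normalizer_of_mem_normalizer_map hq P hy'
          exact ⟨⟨y, hy⟩, rfl⟩
      rw [isPSupersolvable_quotient_iff] at hquot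
      refine isPSupersolvable_iff.2 (.step inferInstance bot_le (.inr ?_) hquot)
      rwa [Subgroup.relIndex_bot_left]

end

theorem theoremA {G : Type*} [Group G] [Finite G] (p : ℕ) [Fact p.Prime]
    (hG : IsPSolvable p G) (P : Sylow p G) :
    IsPSupersolvable p G ↔
      IsPSupersolvable p (Subgroup.normalizer (P : Set G)) ∧
      ∀ x : G, x ∉ Subgroup.normalizer (P : Set G) →
        (∀ H : Subgroup G, H ≤ residualInter P x → Nat.card H = p →
          IsCEmbedded H (P : Subgroup G)) ∧
        (p = 2 → ¬ IsQuaternionFree (residualInter P x) →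
          ∀ H : Subgroup G, H ≤ residualInter P x → IsCyclic H → Nat.card H = 4 →
            IsCEmbedded H (P : Subgroup G)) := by
  constructor
  · intro h
    refine ⟨h.of_injective _ (Subgroup.subtype_injective _), fun x _ => ?_⟩
    have hbot : ∀ H : Subgroup G, H ≤ residualInter P x → Nat.card H = 1 := by
      intro H hH
      have h1 : H ≤ pSupersolvableResidual p G := hH.trans (inf_le_left.trans inf_le_left)
      rw [h.residual_eq_bot, le_bot_iff] at h1
      rw [h1, Subgroup.card_bot]
    refine ⟨fun H hH hcard => ?_, fun _ _ H hH _ hcard => ?_⟩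
    · exact absurd ((hbot H hH).symm.trans hcard) (Fact.out : p.Prime).one_lt.ne
    · exact absurd ((hbot H hH).symm.trans hcard) (by decide)
  · exact fun h => isPSupersolvable_of_embeddingCondition _ G rfl hG P h.1 h.2
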